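/- Let $n\in\{1,2\}$, let $\Omega\subset\mathbb R^n$ be a bounded open set, and let $\alpha,T>0$, $I=(0,T)$. Write $(\cdot,\cdot)$ and $\|\cdot\|$ for the inner product and norm of $L^2(\Omega)$ (or $L^2(\Omega)^n$), $\|v\|_1^2=\|v\|^2+\|\nabla v\|^2$, $\|v\|_2^2=\|v\|^2+\|\nabla v\|^2+\|\Delta v\|^2$, and, for an integer $m\ge 3$, let $\|\cdot\|_m$ be the usual norm of $H^m(\Omega)$, $\|v\|_m^2=\sum_{k\le m}\|D^kv\|^2$. Let $H_0^2(\Omega)$ be the closure of $C_c^\infty(\Omega)$ in $H^2(\Omega)$. Let $g:\mathbb R\to\mathbb R^n$, $g_i(s)=-(s+\tfrac12 s^2)$ for $i=1,\dots,n$. Let $r>3$ be an integer and $K>0$. Let $u_0\in H_0^2(\Omega)\cap H^r(\Omega)$ (for instance $u_0\in H^r_0(\Omega)$), and let $u\in L^\infty(I;H_0^2(\Omega))$, with weak time derivative $u_t\in L^2(I;H^2(\Omega))$, be a weak solution of $u_t+\Delta^2u_t-\alpha\Delta u-\nabla\cdot g(u)=0$ with $u(0)=u_0$; that is, for a.e.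 $t\in I$, $$(u_t(t),\chi)+(\Delta u_t(t),\Delta\chi)+\alpha(\nabla u(t),\nabla\chi)=(\nabla\cdot g(u(t)),\chi)\qquad\forall\chi\in H_0^2(\Omega),$$ and the representative of $u$ in $C([0,T];L^2(\Omega))$ takes the value $u_0$ at $t=0$. Assume moreover that $u,u_t\in L^2(I;H^r(\Omega))$. Then there is a constant $C>0$, which may depend on $n,\Omega,\alpha,T,r,K,u_0,u$ but on nothing else, such that the following holds. Let $0<h<1$, and let $S_h\subset H_0^2(\Omega)$ be a finite-dimensional subspace of order of accuracy $r$ with constant $K$, i.e. $$\inf_{\phi\in S_h}\|v-\phi\|_2\le K h^{r-2}\|v\|_r\qquad\forall v\in H_0^2(\Omega)\cap H^r(\Omega).$$ Let $u_0^h\in S_h$, and let $u^h:[0,T]\to S_h$, continuous on $[0,T]$ and differentiable on $(0,T)$, be a semidiscrete Galerkin solution, i.e. for all $\chi\in S_h$ $$(u^h_t(t),\chi)+(\Delta u^h_t(t),\Delta\chi)+\alpha(\nabla u^h(t),\nabla\chi)=-(g(u^h(t)),\nabla\chi)\quad(0<t<T),\qquad (u^h(0),\chi)=(u_0^h,\chi).$$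 Then $$\Big(\operatorname*{ess\,sup}_{t\in I}\|u(t)-u^h(t)\|_2\Big)^2+\int_0^T\|u(t)-u^h(t)\|_1^2\,dt\le C\big(\|u_0-u_0^h\|_2^2+h^{2(r-2)}\big).$$ -/

import Mathlib

open MeasureTheory Set TopologicalSpace
open scoped ENNReal Distributions

noncomputable section

namespace Rosenau

/-- The space `L²(Ω)` for an open set `Ω ⊆ ℝⁿ`, with Lebesgue measure. -/
abbrev L2 {n : ℕ} (Ω : Opens (EuclideanSpace ℝ (Fin n))) : Type :=
  Lp ℝ 2 (volume.restrict (Ω : Set (EuclideanSpace ℝ (Fin n))))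

/-- The classical iterated partial derivative `∂_{w 0} ∂_{w 1} ⋯ ∂_{w (k-1)} φ` at `x`. -/
def partialDeriv {n k : ℕ} (w : Fin k → Fin n) (φ : EuclideanSpace ℝ (Fin n) → ℝ)
    (x : EuclideanSpace ℝ (Fin n)) : ℝ :=
  iteratedFDeriv ℝ k φ x (fun j => EuclideanSpace.single (w j) (1 : ℝ))

/-- `g ∈ L²(Ω)` is the weak derivative `∂_w f` of `f ∈ L²(Ω)`, tested against all
`φ ∈ C_c^∞(Ω)`. -/
def IsWeakDeriv {n k : ℕ} {Ω : Opens (EuclideanSpace ℝ (Fin n))} (w : Fin k → Fin n)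
    (f g : L2 Ω) : Prop :=
  ∀ φ : 𝓓(Ω, ℝ),
    ∫ x in (Ω : Set (EuclideanSpace ℝ (Fin n))), f x * partialDeriv w φ x =
      (-1) ^ k * ∫ x in (Ω : Set (EuclideanSpace ℝ (Fin n))), g x * φ x

/-- The integrands in the definition of the weak derivative are integrable. -/
theorem integrable_mul_partialDeriv {n k : ℕ} {Ω : Opens (EuclideanSpace ℝ (Fin n))}
    (w : Fin k → Fin n) (f : L2 Ω) (φ : 𝓓(Ω, ℝ)) :
    Integrable (fun x => f x * partialDeriv w φ x)
      (volume.restrict (Ω : Set (EuclideanSpace ℝ (Fin n)))) := by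
  have hc : Continuous (partialDeriv w φ) := by
    have h1 : Continuous (iteratedFDeriv ℝ k (φ : EuclideanSpace ℝ (Fin n) → ℝ)) :=
      φ.contDiff.continuous_iteratedFDeriv (by exact_mod_cast le_top)
    unfold partialDeriv
    fun_prop
  have hs : HasCompactSupport (partialDeriv w φ) := by
    refine (φ.hasCompactSupport.iteratedFDeriv (𝕜 := ℝ) k).mono ?_
    intro x hx
    simp only [Function.mem_support, ne_eq] at hx ⊢
    intro h0
    exact hx (by simp [partialDeriv, h0])
  have h2 : MemLp (partialDeriv w φ) 2
      (volume.restrict (Ω : Set (EuclideanSpace ℝ (Fin n)))) :=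
    (hc.memLp_of_hasCompactSupport hs).restrict _
  exact (Lp.memLp f).integrable_mul h2

theorem integrable_mul_test {n : ℕ} {Ω : Opens (EuclideanSpace ℝ (Fin n))}
    (f : L2 Ω) (φ : 𝓓(Ω, ℝ)) :
    Integrable (fun x => f x * φ x)
      (volume.restrict (Ω : Set (EuclideanSpace ℝ (Fin n)))) := by
  have h2 : MemLp φ 2 (volume.restrict (Ω : Set (EuclideanSpace ℝ (Fin n)))) :=
    (φ.continuous.memLp_of_hasCompactSupport φ.hasCompactSupport).restrict _
  exact (Lp.memLp f).integrable_mul h2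

theorem IsWeakDeriv.zero {n k : ℕ} {Ω : Opens (EuclideanSpace ℝ (Fin n))}
    (w : Fin k → Fin n) : IsWeakDeriv w (0 : L2 Ω) 0 := by
  intro φ
  have h0 := Lp.coeFn_zero (E := ℝ) (p := 2)
    (μ := volume.restrict (Ω : Set (EuclideanSpace ℝ (Fin n))))
  have h1 : ∀ ψ : EuclideanSpace ℝ (Fin n) → ℝ,
      ∫ x in (Ω : Set (EuclideanSpace ℝ (Fin n))), (0 : L2 Ω) x * ψ x = 0 := by
    intro ψ
    apply integral_eq_zero_of_ae
    filter_upwards [h0] with x hx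
    rw [hx, Pi.zero_apply, zero_mul]
  rw [h1, h1, mul_zero]

theorem IsWeakDeriv.add {n k : ℕ} {Ω : Opens (EuclideanSpace ℝ (Fin n))}
    {w : Fin k → Fin n} {f g f' g' : L2 Ω} (h : IsWeakDeriv w f g) (h' : IsWeakDeriv w f' g') :
    IsWeakDeriv w (f + f') (g + g') := by
  intro φ
  have e1 : ∫ x in (Ω : Set (EuclideanSpace ℝ (Fin n))), (f + f') x * partialDeriv w φ x =
      ∫ x in (Ω : Set (EuclideanSpace ℝ (Fin n))),
        (f x * partialDeriv w φ x + f' x * partialDeriv w φ x) := by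
    apply integral_congr_ae
    filter_upwards [Lp.coeFn_add f f'] with x hx
    rw [hx, Pi.add_apply, add_mul]
  have e2 : ∫ x in (Ω : Set (EuclideanSpace ℝ (Fin n))), (g + g') x * φ x =
      ∫ x in (Ω : Set (EuclideanSpace ℝ (Fin n))), (g x * φ x + g' x * φ x) := by
    apply integral_congr_ae
    filter_upwards [Lp.coeFn_add g g'] with x hx
    rw [hx, Pi.add_apply, add_mul]
  rw [e1, e2, integral_add (integrable_mul_partialDeriv w f φ) (integrable_mul_partialDeriv w f' φ),
    integral_add (integrable_mul_test g φ) (integrable_mul_test g' φ), h φ, h' φ, mul_add]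

theorem IsWeakDeriv.smul {n k : ℕ} {Ω : Opens (EuclideanSpace ℝ (Fin n))}
    {w : Fin k → Fin n} {f g : L2 Ω} (c : ℝ) (h : IsWeakDeriv w f g) :
    IsWeakDeriv w (c • f) (c • g) := by
  intro φ
  have e : ∀ (f : L2 Ω) (ψ : EuclideanSpace ℝ (Fin n) → ℝ),
      ∫ x in (Ω : Set (EuclideanSpace ℝ (Fin n))), (c • f) x * ψ x =
        c * ∫ x in (Ω : Set (EuclideanSpace ℝ (Fin n))), f x * ψ x := by
    intro f ψ
    rw [← integral_const_mul]
    apply integral_congr_ae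
    filter_upwards [Lp.coeFn_smul c f] with x hx
    rw [hx, Pi.smul_apply, smul_eq_mul, mul_assoc]
  rw [e, e, h φ]
  ring

/-- Indices of the partial derivatives of order at most `m`: an order `k ≤ m` together with
the `k` directions of differentiation. -/
abbrev JetIndex (n m : ℕ) : Type := Σ k : Fin (m + 1), (Fin (k : ℕ) → Fin n)

/-- The index of the function itself. -/
def JetIndex.root (n m : ℕ) : JetIndex n m := ⟨⟨0, Nat.succ_pos m⟩, Fin.elim0⟩

/-- The Sobolev space `H^m(Ω)`. An element is a function of `L²(Ω)` bundled with its (unique) weak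
partial derivatives of order at most `m`, all in `L²(Ω)`; the norm inherited from the Hilbert sum is
`‖u‖² = ∑_{k ≤ m} ∑_{i₁, …, i_k} ‖∂_{i₁} ⋯ ∂_{i_k} u‖²_{L²(Ω)}`. -/
def Sobolev {n : ℕ} (Ω : Opens (EuclideanSpace ℝ (Fin n))) (m : ℕ) :
    Submodule ℝ (PiLp 2 (fun _ : JetIndex n m => L2 Ω)) where
  carrier := {U | ∀ w : JetIndex n m, IsWeakDeriv w.2 (U (JetIndex.root n m)) (U w)}
  zero_mem' := fun w => IsWeakDeriv.zero w.2
  add_mem' := fun h h' w => (h w).add (h' w)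
  smul_mem' := fun c _ h w => (h w).smul c

namespace Sobolev

variable {n : ℕ} {Ω : Opens (EuclideanSpace ℝ (Fin n))} {m : ℕ}

/-- The underlying `L²(Ω)` function. -/
def fn (u : Sobolev Ω m) : L2 Ω := u.1 (JetIndex.root n m)

/-- The weak gradient of a function in `H²(Ω)`. -/
def grad (u : Sobolev Ω 2) (i : Fin n) : L2 Ω := u.1 ⟨1, ![i]⟩

/-- The weak Laplacian of a function in `H²(Ω)`. -/
def lap (u : Sobolev Ω 2) : L2 Ω := ∑ i : Fin n, u.1 ⟨2, ![i, i]⟩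

/-- `‖u‖₁ = (‖u‖² + ‖∇u‖²)^{1/2}`. -/
def norm1 (u : Sobolev Ω 2) : ℝ := √(‖fn u‖ ^ 2 + ∑ i, ‖grad u i‖ ^ 2)

/-- `‖u‖₂ = (‖u‖² + ‖∇u‖² + ‖Δu‖²)^{1/2}`. -/
def norm2 (u : Sobolev Ω 2) : ℝ := √(‖fn u‖ ^ 2 + ∑ i, ‖grad u i‖ ^ 2 + ‖lap u‖ ^ 2)

end Sobolev

open Sobolev

/-- `H²₀(Ω)`: the closure of `C_c^∞(Ω)` in `H²(Ω)`. -/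
def H02 {n : ℕ} (Ω : Opens (EuclideanSpace ℝ (Fin n))) : Submodule ℝ (Sobolev Ω 2) :=
  (Submodule.span ℝ {u : Sobolev Ω 2 | ∃ φ : 𝓓(Ω, ℝ),
    fn u =ᵐ[volume.restrict (Ω : Set (EuclideanSpace ℝ (Fin n)))] φ}).topologicalClosure

/-- The nonlinearity `g : ℝ → ℝⁿ`, `g_i(s) = -(s + s²/2)`. -/
def flux (n : ℕ) (s : ℝ) : Fin n → ℝ := fun _ => -(s + s ^ 2 / 2)

/-- `d ∈ L²(Ω)` is the weak divergence of the vector field `F` on `Ω`. -/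
def IsWeakDiv {n : ℕ} {Ω : Opens (EuclideanSpace ℝ (Fin n))}
    (F : EuclideanSpace ℝ (Fin n) → Fin n → ℝ) (d : L2 Ω) : Prop :=
  ∀ φ : 𝓓(Ω, ℝ),
    ∫ x in (Ω : Set (EuclideanSpace ℝ (Fin n))), ∑ i, F x i * partialDeriv ![i] φ x =
      -∫ x in (Ω : Set (EuclideanSpace ℝ (Fin n))), d x * φ x

/-- The time interval `I = (0, T)`. -/
def timeInterval (T : ℝ) : Opens ℝ := ⟨Ioo 0 T, isOpen_Ioo⟩

/-- Lebesgue measure on `I = (0, T)`. -/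
def timeMeasure (T : ℝ) : Measure ℝ := volume.restrict (Ioo 0 T)

/-- `v` is the weak (distributional) time derivative on `(0, T)` of the `L²(Ω)`-valued `u`. -/
def IsWeakTimeDeriv {n : ℕ} {Ω : Opens (EuclideanSpace ℝ (Fin n))} (T : ℝ)
    (u v : ℝ → L2 Ω) : Prop :=
  ∀ ψ : 𝓓(timeInterval T, ℝ),
    ∫ t, deriv ψ t • u t ∂(timeMeasure T) = -∫ t, ψ t • v t ∂(timeMeasure T)

/-- `u(0) = u₀` for the representative of `u` that is continuous on `[0, T]` with values
in `L²(Ω)`. -/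
def HasInitialValue {n : ℕ} {Ω : Opens (EuclideanSpace ℝ (Fin n))} (T : ℝ)
    (u : ℝ → L2 Ω) (u₀ : L2 Ω) : Prop :=
  ∃ v : ℝ → L2 Ω, ContinuousOn v (Icc 0 T) ∧ u =ᵐ[timeMeasure T] v ∧ v 0 = u₀

/-- `u ∈ L²(I; H^m(Ω))`, for an `L²(Ω)`-valued function `u`. -/
def InL2Sobolev {n : ℕ} {Ω : Opens (EuclideanSpace ℝ (Fin n))} (T : ℝ) (m : ℕ)
    (u : ℝ → L2 Ω) : Prop :=
  ∃ U : ℝ → Sobolev Ω m, MemLp U 2 (timeMeasure T) ∧ ∀ᵐ t ∂(timeMeasure T), fn (U t) = u t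

/-- `u`, with time derivative `u_t`, is a weak solution of
`u_t + Δ²u_t - α Δu - ∇·g(u) = 0`, `u(0) = u₀`, on `Ω × (0, T)`. (As `I` is bounded,
`u ∈ L^∞(I; H²₀(Ω))` contains `u ∈ L²(I; H¹₀(Ω))`.) -/
structure IsWeakSolution {n : ℕ} {Ω : Opens (EuclideanSpace ℝ (Fin n))} (α T : ℝ) (u₀ : H02 Ω)
    (u : ℝ → H02 Ω) (ut : ℝ → Sobolev Ω 2) : Prop where
  memLp_u : MemLp u ∞ (timeMeasure T)
  memLp_ut : MemLp ut 2 (timeMeasure T)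
  weakTimeDeriv : IsWeakTimeDeriv T (fun t => fn (u t : Sobolev Ω 2)) (fun t => fn (ut t))
  equation : ∀ᵐ t ∂(timeMeasure T), ∃ d : L2 Ω,
    IsWeakDiv (fun x => flux n (fn (u t : Sobolev Ω 2) x)) d ∧
    ∀ χ : H02 Ω,
      inner ℝ (fn (ut t)) (fn (χ : Sobolev Ω 2)) + inner ℝ (lap (ut t)) (lap (χ : Sobolev Ω 2)) +
        α * ∑ i, inner ℝ (grad (u t : Sobolev Ω 2) i) (grad (χ : Sobolev Ω 2) i) =
      inner ℝ d (fn (χ : Sobolev Ω 2))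
  initial : HasInitialValue T (fun t => fn (u t : Sobolev Ω 2)) (fn (u₀ : Sobolev Ω 2))

/-- `S ⊆ H²₀(Ω)` has order of accuracy `r` at mesh size `h`, with constant `K`:
`inf_{φ ∈ S} ‖v - φ‖₂ ≤ K h^{r-2} ‖v‖_r` for all `v ∈ H²₀(Ω) ∩ H^r(Ω)`. -/
def HasApproxOrder {n : ℕ} {Ω : Opens (EuclideanSpace ℝ (Fin n))} (S : Submodule ℝ (H02 Ω))
    (r : ℕ) (K h : ℝ) : Prop :=
  ∀ (v : H02 Ω) (w : Sobolev Ω r), fn w = fn (v : Sobolev Ω 2) →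
    ⨅ φ : S, norm2 ((v - (φ : H02 Ω) : H02 Ω) : Sobolev Ω 2) ≤ K * h ^ (r - 2) * ‖w‖

/-- `uh : [0, T] → S` is a semidiscrete Galerkin solution with initial datum `u0h ∈ S`. -/
structure IsSemidiscreteSolution {n : ℕ} {Ω : Opens (EuclideanSpace ℝ (Fin n))} (α T : ℝ)
    (S : Submodule ℝ (H02 Ω)) (u0h : S) (uh : ℝ → S) : Prop where
  continuousOn : ContinuousOn uh (Icc 0 T)
  equation : ∀ t ∈ Ioo 0 T, ∃ uht : S, HasDerivAt uh uht t ∧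
    ∀ χ : S,
      inner ℝ (fn ((uht : H02 Ω) : Sobolev Ω 2)) (fn ((χ : H02 Ω) : Sobolev Ω 2)) +
        inner ℝ (lap ((uht : H02 Ω) : Sobolev Ω 2)) (lap ((χ : H02 Ω) : Sobolev Ω 2)) +
        α * ∑ i, inner ℝ (grad ((uh t : H02 Ω) : Sobolev Ω 2) i)
          (grad ((χ : H02 Ω) : Sobolev Ω 2) i) =
      -∫ x in (Ω : Set (EuclideanSpace ℝ (Fin n))),
        ∑ i, flux n (fn ((uh t : H02 Ω) : Sobolev Ω 2) x) i *
          grad ((χ : H02 Ω) : Sobolev Ω 2) i x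
  initial : ∀ χ : S,
    inner ℝ (fn ((uh 0 : H02 Ω) : Sobolev Ω 2)) (fn ((χ : H02 Ω) : Sobolev Ω 2)) =
      inner ℝ (fn ((u0h : H02 Ω) : Sobolev Ω 2)) (fn ((χ : H02 Ω) : Sobolev Ω 2))

end Rosenau

end

noncomputable section

namespace Rosenau

open Filter Topology
open scoped RealInnerProductSpace

variable {n m : ℕ} {Ω : Opens (EuclideanSpace ℝ (Fin n))}

/-! ### Test functions -/

/-! On `H02` use the energy norm `|v|² = ‖v‖² + ‖Δv‖²`. Green's formula gives `‖∇v‖² = -(Δv, v) ≤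
|v|²/2`, so this norm is equivalent to `norm2` (`norm2_sq_le`, `norm_energyMap_le_norm2`). In the
energy inner product both problems read `⟨u, χ⟩' = Φ(u, χ)`, where `Φ(v, χ) = -α(∇v, ∇χ) - (g(v),
∇χ)` involves only first derivatives. The exact solution satisfies this for all `χ` in `H02`, the
discrete one for `χ` in `S`.

Write the error as `U - uh = ρ + θ`, with `θ` its energy projection on `S`. Then `ρ` is orthogonal
to `S`, so `|ρ|` is the distance from `U` to `S`. It is at most `K h^(r-2) ‖U‖_r`, and also at most
`|U|`. Orthogonality removes `ρ` from the time derivative: `(|θ|²)' = 2(Φ(U, θ) - Φ(uh, θ))`.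

Expanding with `uh = U - ρ - θ`, the only cubic term in `θ` is a multiple of `∫ θ² ∂θ`, which
vanishes (`inner_product_self_sumGrad`). The embedding of `H02` in `L⁴`, valid for `n ≤ 2`, bounds
the rest by `D(|ρ|² + |θ|²)` with `D` depending on `U` but not on `uh` (`rosenauForm_sub_le`). Hence
no a priori bound on `uh` and no smallness of `h` is needed, and Grönwall's inequality concludes
(`norm_sq_sub_le_of_galerkin`).

To differentiate classically, the weak solution is replaced by `U = u₀ + ∫ ut`, continuous into
`H02`. The same primitive taken in `H^r` bounds `‖U(t)‖_r` uniformly in time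
(`exists_sobolev_bound`). -/

theorem memLp_of_test (φ : 𝓓(Ω, ℝ)) (p : ℝ≥0∞) :
    MemLp φ p (volume.restrict (Ω : Set (EuclideanSpace ℝ (Fin n)))) :=
  (φ.continuous.memLp_of_hasCompactSupport φ.hasCompactSupport).restrict _

theorem partialDeriv_single (i : Fin n) (φ : EuclideanSpace ℝ (Fin n) → ℝ)
    (x : EuclideanSpace ℝ (Fin n)) :
    partialDeriv ![i] φ x = fderiv ℝ φ x (EuclideanSpace.single i 1) := by
  simp [partialDeriv, iteratedFDeriv_one_apply]

/-- The `i`-th partial derivative of a test function, as a test function. -/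
def pderivTest (i : Fin n) (φ : 𝓓(Ω, ℝ)) : 𝓓(Ω, ℝ) where
  toFun x := fderiv ℝ φ x (EuclideanSpace.single i 1)
  contDiff' := by
    have h : ContDiff ℝ (⊤ : ℕ∞) (fderiv ℝ φ) :=
      φ.contDiff.fderiv_right (m := (⊤ : ℕ∞)) (by exact_mod_cast le_top)
    exact h.clm_apply contDiff_const
  hasCompactSupport' := φ.hasCompactSupport.fderiv_apply (𝕜 := ℝ) _
  tsupport_subset' := (tsupport_fderiv_apply_subset ℝ _).trans φ.tsupport_subset

theorem pderivTest_apply (i : Fin n) (φ : 𝓓(Ω, ℝ)) (x : EuclideanSpace ℝ (Fin n)) :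
    pderivTest i φ x = fderiv ℝ φ x (EuclideanSpace.single i 1) := rfl

theorem partialDeriv_single_eq (i : Fin n) (φ : 𝓓(Ω, ℝ)) :
    partialDeriv ![i] φ = pderivTest i φ :=
  funext fun x => partialDeriv_single i φ x

theorem partialDeriv_pair_eq (i : Fin n) (φ : 𝓓(Ω, ℝ)) :
    partialDeriv ![i, i] φ = pderivTest i (pderivTest i φ) := by
  funext x
  have h : DifferentiableAt ℝ (fderiv ℝ φ) x :=
    ((φ.contDiff.fderiv_right (m := (⊤ : ℕ∞)) (by exact_mod_cast le_top)).differentiable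
      (by simp)) x
  rw [pderivTest_apply]
  have e : (pderivTest i φ : EuclideanSpace ℝ (Fin n) → ℝ) =
      fun y => fderiv ℝ φ y (EuclideanSpace.single i 1) := rfl
  rw [e, fderiv_clm_apply h (differentiableAt_const _)]
  simp [partialDeriv, iteratedFDeriv_two_apply]

/-- The compact support of `φ` in `Ω` turns both integrals into integrals over the whole space, so
no regularity of the boundary enters. -/
theorem integral_mul_pderiv_test (i : Fin n) (f : EuclideanSpace ℝ (Fin n) → ℝ)
    (hf : ContDiff ℝ 1 f) (φ : 𝓓(Ω, ℝ)) :
    ∫ x in (Ω : Set (EuclideanSpace ℝ (Fin n))), f x * pderivTest i φ x =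
      -∫ x in (Ω : Set (EuclideanSpace ℝ (Fin n))),
        fderiv ℝ f x (EuclideanSpace.single i 1) * φ x := by
  have hs : ∀ (g : EuclideanSpace ℝ (Fin n) → ℝ) (ψ : 𝓓(Ω, ℝ)),
      ∫ x in (Ω : Set (EuclideanSpace ℝ (Fin n))), g x * ψ x = ∫ x, g x * ψ x := by
    intro g ψ
    apply setIntegral_eq_integral_of_forall_compl_eq_zero
    intro x hx
    rw [image_eq_zero_of_notMem_tsupport (fun h => hx (ψ.tsupport_subset h)), mul_zero]
  have hi : ∀ (g : EuclideanSpace ℝ (Fin n) → ℝ) (ψ : 𝓓(Ω, ℝ)), Continuous g →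
      Integrable fun x => g x * ψ x := fun g ψ hg =>
    (hg.mul ψ.continuous).integrable_of_hasCompactSupport ψ.hasCompactSupport.mul_left
  have hf' : Continuous fun x => fderiv ℝ f x (EuclideanSpace.single i 1) :=
    (hf.continuous_fderiv one_ne_zero).clm_apply continuous_const
  rw [hs, hs]
  exact integral_mul_fderiv_eq_neg_fderiv_mul_of_integrable (hi _ _ hf')
    (hi _ (pderivTest i φ) hf.continuous) (hi _ _ hf.continuous)
    (fun x _ => hf.differentiable one_ne_zero x)
    (fun x _ => φ.contDiff.differentiable (by simp) x)

/-- A test function as an element of `L²(Ω)`. -/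
def testL2 (φ : 𝓓(Ω, ℝ)) : L2 Ω := (memLp_of_test φ 2).toLp

theorem coeFn_testL2 (φ : 𝓓(Ω, ℝ)) :
    testL2 φ =ᵐ[volume.restrict (Ω : Set (EuclideanSpace ℝ (Fin n)))] φ :=
  MemLp.coeFn_toLp _

theorem inner_L2_eq_integral (f g : L2 Ω) :
    ⟪f, g⟫ = ∫ x in (Ω : Set (EuclideanSpace ℝ (Fin n))), f x * g x := by
  rw [MeasureTheory.L2.inner_def]
  exact integral_congr_ae (Eventually.of_forall fun x => by simp [mul_comm])

theorem inner_toLp (f : L2 Ω) {g : EuclideanSpace ℝ (Fin n) → ℝ}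
    (hg : MemLp g 2 (volume.restrict (Ω : Set (EuclideanSpace ℝ (Fin n))))) :
    ⟪f, hg.toLp⟫ = ∫ x in (Ω : Set (EuclideanSpace ℝ (Fin n))), f x * g x := by
  rw [inner_L2_eq_integral]
  apply integral_congr_ae
  filter_upwards [hg.coeFn_toLp] with x hx
  rw [hx]

theorem inner_testL2 (f : L2 Ω) (φ : 𝓓(Ω, ℝ)) :
    ⟪f, testL2 φ⟫ = ∫ x in (Ω : Set (EuclideanSpace ℝ (Fin n))), f x * φ x :=
  inner_toLp f _

/-- The fundamental lemma of the calculus of variations. It yields uniqueness of weak derivatives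
and hence injectivity of `fnL`. -/
theorem eq_zero_of_inner_testL2 {f : L2 Ω} (h : ∀ φ : 𝓓(Ω, ℝ), ⟪f, testL2 φ⟫ = 0) : f = 0 := by
  have hloc : LocallyIntegrableOn f (Ω : Set (EuclideanSpace ℝ (Fin n))) volume :=
    locallyIntegrableOn_of_locallyIntegrable_restrict
      ((Lp.memLp f).locallyIntegrable (by norm_num))
  have h0 := Ω.isOpen.ae_eq_zero_of_integral_contDiff_smul_eq_zero hloc (fun g hg hgc hgs => by
    have h1 := h ⟨g, hg, hgc, hgs⟩
    rw [inner_testL2] at h1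
    rw [← h1]
    symm
    rw [setIntegral_eq_integral_of_forall_compl_eq_zero]
    · exact integral_congr_ae (Eventually.of_forall fun x => by simp [mul_comm])
    · intro x hx
      simp only [TestFunction.coe_mk]
      rw [image_eq_zero_of_notMem_tsupport (fun h => hx (hgs h)), mul_zero])
  rw [Lp.eq_zero_iff_ae_eq_zero]
  exact (ae_restrict_iff' Ω.isOpen.measurableSet).2 h0

theorem eq_of_inner_testL2 {f g : L2 Ω} (h : ∀ φ : 𝓓(Ω, ℝ), ⟪f, testL2 φ⟫ = ⟪g, testL2 φ⟫) :
    f = g := by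
  rw [← sub_eq_zero]
  exact eq_zero_of_inner_testL2 fun φ => by rw [inner_sub_left, h φ, sub_self]

/-! ### Sobolev spaces -/

theorem memLp_partialDeriv {k : ℕ} (w : Fin k → Fin n) (φ : 𝓓(Ω, ℝ)) :
    MemLp (partialDeriv w φ) 2 (volume.restrict (Ω : Set (EuclideanSpace ℝ (Fin n)))) := by
  have hc : Continuous (partialDeriv w φ) := by
    have h1 : Continuous (iteratedFDeriv ℝ k (φ : EuclideanSpace ℝ (Fin n) → ℝ)) :=
      φ.contDiff.continuous_iteratedFDeriv (by exact_mod_cast le_top)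
    unfold partialDeriv
    fun_prop
  have hs : HasCompactSupport (partialDeriv w φ) := by
    refine (φ.hasCompactSupport.iteratedFDeriv (𝕜 := ℝ) k).mono fun x hx => ?_
    simp only [Function.mem_support, ne_eq] at hx ⊢
    exact fun h0 => hx (by simp [partialDeriv, h0])
  exact (hc.memLp_of_hasCompactSupport hs).restrict _

theorem isWeakDeriv_iff_inner {k : ℕ} {w : Fin k → Fin n} {f g : L2 Ω} :
    IsWeakDeriv w f g ↔
      ∀ φ : 𝓓(Ω, ℝ), ⟪f, (memLp_partialDeriv w φ).toLp⟫ = (-1) ^ k * ⟪g, testL2 φ⟫ := by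
  simp only [inner_toLp, inner_testL2]
  rfl

theorem IsWeakDeriv.unique {k : ℕ} {w : Fin k → Fin n} {f g g' : L2 Ω}
    (h : IsWeakDeriv w f g) (h' : IsWeakDeriv w f g') : g = g' := by
  rw [isWeakDeriv_iff_inner] at h h'
  refine eq_of_inner_testL2 fun φ => ?_
  have h1 := (h φ).symm.trans (h' φ)
  exact mul_left_cancel₀ (pow_ne_zero _ (by norm_num)) h1

/-- Each condition defining a weak derivative equates two continuous linear functionals. The
resulting completeness is what makes Bochner integrals with values in `Sobolev Ω m` meaningful. -/
theorem isClosed_sobolev : IsClosed (Sobolev Ω m : Set (PiLp 2 fun _ : JetIndex n m => L2 Ω)) := by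
  have : (Sobolev Ω m : Set (PiLp 2 fun _ : JetIndex n m => L2 Ω)) =
      ⋂ (w : JetIndex n m) (φ : 𝓓(Ω, ℝ)),
        {U | ⟪U (JetIndex.root n m), (memLp_partialDeriv w.2 φ).toLp⟫ =
          (-1) ^ (w.1 : ℕ) * ⟪U w, testL2 φ⟫} := by
    ext U
    simp only [Set.mem_iInter, Set.mem_ofPred_eq]
    exact forall_congr' fun w => isWeakDeriv_iff_inner
  rw [this]
  refine isClosed_iInter fun w => isClosed_iInter fun φ => isClosed_eq ?_ ?_
  · fun_prop
  · fun_prop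

instance : CompleteSpace (Sobolev Ω m) := isClosed_sobolev.completeSpace_coe

/-- The weak derivative with a given index, as a continuous linear map. -/
def jetL (w : JetIndex n m) : Sobolev Ω m →L[ℝ] L2 Ω :=
  (PiLp.proj 2 (fun _ : JetIndex n m => L2 Ω) w).comp (Sobolev Ω m).subtypeL

/-- The underlying function, as a continuous linear map. -/
def fnL : Sobolev Ω m →L[ℝ] L2 Ω := jetL (JetIndex.root n m)

/-- The `i`-th component of the weak gradient, as a continuous linear map. -/
def gradL (i : Fin n) : Sobolev Ω 2 →L[ℝ] L2 Ω := jetL ⟨1, ![i]⟩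

/-- The weak Laplacian as a continuous linear map. -/
def lapL : Sobolev Ω 2 →L[ℝ] L2 Ω := ∑ i : Fin n, jetL ⟨2, ![i, i]⟩

theorem fnL_apply (u : Sobolev Ω m) : fnL u = Sobolev.fn u := rfl

theorem gradL_apply (i : Fin n) (u : Sobolev Ω 2) : gradL i u = Sobolev.grad u i := rfl

theorem lapL_apply (u : Sobolev Ω 2) : lapL u = Sobolev.lap u := by
  simp only [lapL, sum_apply]
  rfl

theorem fnL_injective : Function.Injective (fnL : Sobolev Ω m → L2 Ω) := by
  intro u v h
  apply Subtype.ext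
  ext1 w
  have hv := v.2 w
  have e : v.1 (JetIndex.root n m) = u.1 (JetIndex.root n m) := h.symm
  rw [e] at hv
  exact (u.2 w).unique hv

theorem inner_grad_testL2 (u : Sobolev Ω 2) (i : Fin n) (φ : 𝓓(Ω, ℝ)) :
    ⟪Sobolev.grad u i, testL2 φ⟫ = -⟪Sobolev.fn u, testL2 (pderivTest i φ)⟫ := by
  have h : IsWeakDeriv ![i] (Sobolev.fn u) (Sobolev.grad u i) := u.2 ⟨1, ![i]⟩
  have h1 := h φ
  rw [partialDeriv_single_eq, ← inner_testL2, ← inner_testL2] at h1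
  linarith

theorem grad_eq_testL2 {u : Sobolev Ω 2} {φ : 𝓓(Ω, ℝ)} (h : Sobolev.fn u = testL2 φ) (i : Fin n) :
    Sobolev.grad u i = testL2 (pderivTest i φ) := by
  refine eq_of_inner_testL2 fun ψ => ?_
  rw [inner_grad_testL2, h, real_inner_comm, inner_testL2, real_inner_comm, inner_testL2]
  have h1 := integral_mul_pderiv_test i ψ (ψ.contDiff.of_le (by exact_mod_cast le_top)) φ
  have e : ∀ ψ φ : 𝓓(Ω, ℝ), ∫ x in (Ω : Set (EuclideanSpace ℝ (Fin n))), testL2 ψ x * φ x =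
      ∫ x in (Ω : Set (EuclideanSpace ℝ (Fin n))), ψ x * φ x := by
    intro ψ φ
    apply integral_congr_ae
    filter_upwards [coeFn_testL2 ψ] with x hx
    rw [hx]
  rw [e, e, h1]
  rfl

/-- Test functions already form a linear space, so the span in the definition of `H02` adds nothing
and a density argument only has to treat one test function. -/
theorem H02_induction {p : Sobolev Ω 2 → Prop} (hc : IsClosed {u | p u})
    (ht : ∀ (u : Sobolev Ω 2) (φ : 𝓓(Ω, ℝ)), Sobolev.fn u = testL2 φ → p u)
    (u : H02 Ω) : p u := by
  have hu : (u : Sobolev Ω 2) ∈ closure ((Submodule.span ℝ {u : Sobolev Ω 2 | ∃ φ : 𝓓(Ω, ℝ),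
    Sobolev.fn u =ᵐ[volume.restrict (Ω : Set (EuclideanSpace ℝ (Fin n)))] φ} :
      Submodule ℝ (Sobolev Ω 2)) : Set (Sobolev Ω 2)) := u.2
  refine closure_minimal ?_ hc hu
  intro v hv
  have hv' : ∃ φ : 𝓓(Ω, ℝ), Sobolev.fn v = testL2 φ := by
    refine Submodule.span_induction ?_ ?_ ?_ ?_ hv
    · rintro v ⟨φ, hφ⟩
      exact ⟨φ, Lp.ext (hφ.trans (coeFn_testL2 φ).symm)⟩
    · refine ⟨0, Lp.ext ?_⟩
      filter_upwards [coeFn_testL2 (0 : 𝓓(Ω, ℝ)),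
        Lp.coeFn_zero ℝ 2 (volume.restrict (Ω : Set (EuclideanSpace ℝ (Fin n))))] with x h1 h2
      rw [h1]
      exact h2
    · rintro v w _ _ ⟨φ, hφ⟩ ⟨ψ, hψ⟩
      refine ⟨φ + ψ, Lp.ext ?_⟩
      have e : Sobolev.fn (v + w) = testL2 φ + testL2 ψ := by
        rw [← hφ, ← hψ]
        rfl
      rw [e]
      filter_upwards [coeFn_testL2 φ, coeFn_testL2 ψ, coeFn_testL2 (φ + ψ),
        Lp.coeFn_add (testL2 φ) (testL2 ψ)] with x h1 h2 h3 h4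
      rw [h4, h3, Pi.add_apply, h1, h2]
      rfl
    · rintro c v _ ⟨φ, hφ⟩
      refine ⟨c • φ, Lp.ext ?_⟩
      have e : Sobolev.fn (c • v) = c • testL2 φ := by
        rw [← hφ]
        rfl
      rw [e]
      filter_upwards [coeFn_testL2 φ, coeFn_testL2 (c • φ),
        Lp.coeFn_smul c (testL2 φ)] with x h1 h2 h3
      rw [h3, h2, Pi.smul_apply, h1]
      rfl
  obtain ⟨φ, hφ⟩ := hv'
  exact ht v φ hφ

/-- Green's formula. -/
theorem sum_inner_grad_eq (u : Sobolev Ω 2) (χ : H02 Ω) :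
    ∑ i, ⟪Sobolev.grad u i, Sobolev.grad (χ : Sobolev Ω 2) i⟫ =
      -⟪Sobolev.lap u, Sobolev.fn (χ : Sobolev Ω 2)⟫ := by
  -- Only `χ` needs the boundary condition: for a test function the formula is the definition of the
  -- weak derivatives of `u`, and both sides are continuous in `χ`.
  refine H02_induction (p := fun v => ∑ i, ⟪Sobolev.grad u i, Sobolev.grad v i⟫ =
      -⟪Sobolev.lap u, Sobolev.fn v⟫) ?_ ?_ χ
  · simp only [← gradL_apply, ← fnL_apply]
    exact isClosed_eq (by fun_prop) (by fun_prop)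
  · intro v φ hφ
    rw [Sobolev.lap, sum_inner, ← Finset.sum_neg_distrib]
    refine Finset.sum_congr rfl fun i _ => ?_
    rw [grad_eq_testL2 hφ, hφ, inner_grad_testL2]
    have h : IsWeakDeriv ![i, i] (Sobolev.fn u) (u.1 ⟨2, ![i, i]⟩) := u.2 ⟨2, ![i, i]⟩
    have h1 := h φ
    rw [partialDeriv_pair_eq, ← inner_testL2, ← inner_testL2] at h1
    rw [h1]
    norm_num


end Rosenau

end

noncomputable section

namespace Rosenau

open Filter Topology
open scoped RealInnerProductSpace

variable {n : ℕ} {Ω : Opens (EuclideanSpace ℝ (Fin n))}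

/-! ### The embedding `H²₀(Ω) ⊆ L⁴(Ω)` in dimensions one and two -/

theorem volume_ne_top_of_isBounded
    (hΩ : Bornology.IsBounded (Ω : Set (EuclideanSpace ℝ (Fin n)))) :
    (volume.restrict (Ω : Set (EuclideanSpace ℝ (Fin n)))) Set.univ ≠ ∞ := by
  rw [Measure.restrict_apply_univ]
  exact hΩ.measure_lt_top.ne

theorem support_fderiv_test_subset (φ : 𝓓(Ω, ℝ)) :
    Function.support (fderiv ℝ φ) ⊆ (Ω : Set (EuclideanSpace ℝ (Fin n))) :=
  (support_fderiv_subset ℝ).trans φ.tsupport_subset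

/-- The fundamental theorem of calculus on the half-line ending at the point, transported through
the measure-preserving isometry between `ℝ` and `EuclideanSpace ℝ (Fin 1)`. -/
theorem enorm_le_eLpNorm_fderiv_of_fin_one {φ : EuclideanSpace ℝ (Fin 1) → ℝ}
    (hφ : ContDiff ℝ 1 φ) (hc : HasCompactSupport φ) (x : EuclideanSpace ℝ (Fin 1)) :
    ‖φ x‖ₑ ≤ eLpNorm (fderiv ℝ φ) 1 volume := by
  let e : ℝ ≃ᵐ EuclideanSpace ℝ (Fin 1) :=
    (MeasurableEquiv.funUnique (Fin 1) ℝ).symm.trans (MeasurableEquiv.toLp 2 (Fin 1 → ℝ))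
  have he : MeasurePreserving e volume volume :=
    (PiLp.volume_preserving_toLp (Fin 1)).comp ((volume_preserving_funUnique (Fin 1) ℝ).symm _)
  let L : ℝ ≃L[ℝ] EuclideanSpace ℝ (Fin 1) :=
    (ContinuousLinearEquiv.funUnique (Fin 1) ℝ ℝ).symm.trans
      (PiLp.continuousLinearEquiv 2 ℝ (fun _ : Fin 1 => ℝ)).symm
  have heL : ∀ s, e s = L s := fun s => rfl
  have hL1 : ‖L 1‖ = 1 := by
    have : L 1 = EuclideanSpace.single 0 1 := by
      ext i
      fin_cases i
      simp [L]
    rw [this]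
    simp
  have h1 := HasCompactSupport.enorm_le_lintegral_Ici_deriv (f := φ ∘ L)
    (hφ.comp L.contDiff) (hc.comp_homeomorph L.toHomeomorph) (L.symm x)
  simp only [Function.comp_apply, ContinuousLinearEquiv.apply_symm_apply] at h1
  rw [eLpNorm_one_eq_lintegral_enorm, ← he.lintegral_comp_emb e.measurableEmbedding]
  refine h1.trans ((setLIntegral_le_lintegral _ _).trans (lintegral_mono fun s => ?_))
  have hd : HasDerivAt (φ ∘ L) (fderiv ℝ φ (L s) (L 1)) s := by
    have := ((hφ.differentiable one_ne_zero (L s)).hasFDerivAt).comp_hasDerivAt s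
      (L : ℝ →L[ℝ] EuclideanSpace ℝ (Fin 1)).hasDerivAt
    exact this
  rw [hd.deriv, heL, enorm_le_iff_norm_le]
  simpa [hL1] using (fderiv ℝ φ (L s)).le_opNorm (L 1)

theorem eLpNorm_restrict_of_support_subset {F : Type*} [NormedAddCommGroup F]
    {f : EuclideanSpace ℝ (Fin n) → F} (p : ℝ≥0∞)
    (h : Function.support f ⊆ (Ω : Set (EuclideanSpace ℝ (Fin n)))) :
    eLpNorm f p (volume.restrict (Ω : Set (EuclideanSpace ℝ (Fin n)))) = eLpNorm f p volume :=
  eLpNorm_restrict_eq_of_support_subset h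

/-- Hölder's inequality on a set of finite measure, used with `p = 1` in dimension one and `p = 4/3`
in dimension two. -/
theorem exists_eLpNorm_fderiv_test_le {p : ℝ≥0∞} (hp0 : p ≠ 0) (hp : p ≤ 2)
    (hΩ : Bornology.IsBounded (Ω : Set (EuclideanSpace ℝ (Fin n)))) :
    ∃ C : ℝ≥0∞, C ≠ ∞ ∧ ∀ φ : 𝓓(Ω, ℝ), eLpNorm (fderiv ℝ φ) p volume ≤
      C * eLpNorm (fderiv ℝ φ) 2 (volume.restrict (Ω : Set (EuclideanSpace ℝ (Fin n)))) := by
  refine ⟨_, ENNReal.rpow_ne_top_of_nonneg (y := 1 / p.toReal - 1 / (2 : ℝ≥0∞).toReal) ?_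
    (volume_ne_top_of_isBounded hΩ), fun φ => ?_⟩
  · have h0 : 0 < p.toReal := ENNReal.toReal_pos hp0 (hp.trans_lt (by norm_num)).ne
    have h1 : p.toReal ≤ (2 : ℝ≥0∞).toReal := ENNReal.toReal_mono (by norm_num) hp
    exact sub_nonneg.2 (one_div_le_one_div_of_le h0 h1)
  · rw [← eLpNorm_restrict_of_support_subset p (support_fderiv_test_subset φ), mul_comm]
    exact eLpNorm_le_eLpNorm_mul_rpow_measure_univ hp
      (φ.contDiff.continuous_fderiv (by simp)).aestronglyMeasurable

theorem exists_eLpNorm_four_le_of_fin_one {Ω : Opens (EuclideanSpace ℝ (Fin 1))}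
    (hΩ : Bornology.IsBounded (Ω : Set (EuclideanSpace ℝ (Fin 1)))) :
    ∃ C : ℝ≥0∞, C ≠ ∞ ∧ ∀ φ : 𝓓(Ω, ℝ),
      eLpNorm φ 4 (volume.restrict (Ω : Set (EuclideanSpace ℝ (Fin 1)))) ≤
        C * eLpNorm (fderiv ℝ φ) 2 (volume.restrict (Ω : Set (EuclideanSpace ℝ (Fin 1)))) := by
  obtain ⟨C, hC, h⟩ := exists_eLpNorm_fderiv_test_le (p := 1) one_ne_zero (by norm_num) hΩ
  refine ⟨_, ENNReal.mul_ne_top (ENNReal.rpow_ne_top_of_nonneg (y := (4 : ℝ≥0∞).toReal⁻¹)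
    (by norm_num) (volume_ne_top_of_isBounded hΩ)) hC, fun φ => ?_⟩
  rw [mul_assoc]
  refine le_trans ?_ (mul_le_mul_right (h φ) _)
  rw [mul_comm]
  exact eLpNorm_le_of_ae_enorm_bound (Eventually.of_forall fun x =>
    enorm_le_eLpNorm_fderiv_of_fin_one (φ.contDiff.of_le (by exact_mod_cast le_top))
      φ.hasCompactSupport x)

theorem exists_eLpNorm_four_le_of_fin_two {Ω : Opens (EuclideanSpace ℝ (Fin 2))}
    (hΩ : Bornology.IsBounded (Ω : Set (EuclideanSpace ℝ (Fin 2)))) :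
    ∃ C : ℝ≥0∞, C ≠ ∞ ∧ ∀ φ : 𝓓(Ω, ℝ),
      eLpNorm φ 4 (volume.restrict (Ω : Set (EuclideanSpace ℝ (Fin 2)))) ≤
        C * eLpNorm (fderiv ℝ φ) 2 (volume.restrict (Ω : Set (EuclideanSpace ℝ (Fin 2)))) := by
  -- The Gagliardo–Nirenberg–Sobolev exponents in dimension two: `1/4 = 3/4 - 1/2`, that is `q = 4`
  -- for `p = 4/3 < 2`.
  obtain ⟨p, hp⟩ : ∃ p : NNReal, (p : ℝ) = 4 / 3 := ⟨⟨4 / 3, by norm_num⟩, rfl⟩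
  obtain ⟨q, hq⟩ : ∃ q : NNReal, (q : ℝ) = 4 := ⟨⟨4, by norm_num⟩, rfl⟩
  have hq4 : (q : ℝ≥0∞) = 4 := by
    have : q = 4 := by
      rw [← NNReal.coe_inj, hq]
      norm_num
    rw [this]
    norm_num
  have hp2 : (p : ℝ≥0∞) ≤ 2 := by
    have : p ≤ 2 := by
      rw [← NNReal.coe_le_coe, hp]
      norm_num
    exact_mod_cast this
  have hp0 : (p : ℝ≥0∞) ≠ 0 := by
    have : p ≠ 0 := by
      rw [ne_eq, ← NNReal.coe_inj, hp]
      norm_num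
    exact_mod_cast this
  obtain ⟨C, hC, h⟩ := exists_eLpNorm_fderiv_test_le hp0 hp2 hΩ
  refine ⟨_, ENNReal.mul_ne_top (ENNReal.coe_ne_top (r := eLpNormLESNormFDerivOfLeConst ℝ volume
      (Ω : Set (EuclideanSpace ℝ (Fin 2))) p q)) hC, fun φ => ?_⟩
  have h3 := eLpNorm_le_eLpNorm_fderiv_of_le volume (p := p) (q := q) (u := φ)
    (φ.contDiff.of_le (by exact_mod_cast le_top))
    ((subset_tsupport φ).trans φ.tsupport_subset)
    (by rw [← NNReal.coe_le_coe, hp]; norm_num)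
    (by rw [finrank_euclideanSpace_fin, ← NNReal.coe_lt_coe, hp]; norm_num)
    (by rw [finrank_euclideanSpace_fin, NNReal.coe_inv, hp, hq]; norm_num) hΩ
  rw [hq4] at h3
  rw [mul_assoc]
  exact (eLpNorm_mono_measure _ Measure.restrict_le_self).trans
    (h3.trans (mul_le_mul_right (h φ) _))

theorem exists_eLpNorm_four_le_eLpNorm_fderiv (hn : 1 ≤ n) (hn2 : n ≤ 2)
    (hΩ : Bornology.IsBounded (Ω : Set (EuclideanSpace ℝ (Fin n)))) :
    ∃ C : ℝ≥0∞, C ≠ ∞ ∧ ∀ φ : 𝓓(Ω, ℝ),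
      eLpNorm φ 4 (volume.restrict (Ω : Set (EuclideanSpace ℝ (Fin n)))) ≤
        C * eLpNorm (fderiv ℝ φ) 2 (volume.restrict (Ω : Set (EuclideanSpace ℝ (Fin n)))) := by
  obtain rfl | rfl : n = 1 ∨ n = 2 := by lia
  · exact exists_eLpNorm_four_le_of_fin_one hΩ
  · exact exists_eLpNorm_four_le_of_fin_two hΩ

theorem norm_le_sum_apply_single (L : EuclideanSpace ℝ (Fin n) →L[ℝ] ℝ) :
    ‖L‖ ≤ ∑ i, ‖L (EuclideanSpace.single i 1)‖ := by
  refine L.opNorm_le_bound (Finset.sum_nonneg fun i _ => norm_nonneg _) fun v => ?_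
  have hv : v = ∑ i, v i • EuclideanSpace.single i (1 : ℝ) := by
    conv_lhs => rw [← (EuclideanSpace.basisFun (Fin n) ℝ).sum_repr v]
    simp
  conv_lhs => rw [hv]
  rw [map_sum, Finset.sum_mul]
  refine (norm_sum_le _ _).trans (Finset.sum_le_sum fun i _ => ?_)
  rw [map_smul, norm_smul, mul_comm]
  gcongr
  exact PiLp.norm_apply_le v i

theorem eLpNorm_fderiv_test_le (φ : 𝓓(Ω, ℝ)) :
    eLpNorm (fderiv ℝ φ) 2 (volume.restrict (Ω : Set (EuclideanSpace ℝ (Fin n)))) ≤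
      ∑ i, eLpNorm (pderivTest i φ) 2
        (volume.restrict (Ω : Set (EuclideanSpace ℝ (Fin n)))) := by
  calc _ ≤ eLpNorm (∑ i, fun x => ‖pderivTest i φ x‖) 2
        (volume.restrict (Ω : Set (EuclideanSpace ℝ (Fin n)))) := by
        refine eLpNorm_mono_real fun x => ?_
        rw [Finset.sum_apply]
        exact norm_le_sum_apply_single _
    _ ≤ ∑ i, eLpNorm (fun x => ‖pderivTest i φ x‖) 2
        (volume.restrict (Ω : Set (EuclideanSpace ℝ (Fin n)))) :=
        eLpNorm_sum_le (fun i _ => (pderivTest i φ).continuous.norm.aestronglyMeasurable)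
          (by norm_num)
    _ = _ := Finset.sum_congr rfl fun i _ => eLpNorm_norm _

theorem eLpNorm_coe_L2 (f : L2 Ω) :
    eLpNorm f 2 (volume.restrict (Ω : Set (EuclideanSpace ℝ (Fin n)))) = ENNReal.ofReal ‖f‖ := by
  rw [Lp.norm_def, ENNReal.ofReal_toReal (Lp.eLpNorm_ne_top f)]

theorem exists_eLpNorm_four_le (hn : 1 ≤ n) (hn2 : n ≤ 2)
    (hΩ : Bornology.IsBounded (Ω : Set (EuclideanSpace ℝ (Fin n)))) :
    ∃ C : ℝ, 0 ≤ C ∧ ∀ v : H02 Ω,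
      eLpNorm (Sobolev.fn (v : Sobolev Ω 2)) 4
        (volume.restrict (Ω : Set (EuclideanSpace ℝ (Fin n)))) ≤
        ENNReal.ofReal (C * ∑ i, ‖Sobolev.grad (v : Sobolev Ω 2) i‖) := by
  obtain ⟨C, hC, h⟩ := exists_eLpNorm_four_le_eLpNorm_fderiv hn hn2 hΩ
  refine ⟨C.toReal, ENNReal.toReal_nonneg, fun v => ?_⟩
  refine H02_induction (p := fun v => eLpNorm (Sobolev.fn v) 4
        (volume.restrict (Ω : Set (EuclideanSpace ℝ (Fin n)))) ≤
        ENNReal.ofReal (C.toReal * ∑ i, ‖Sobolev.grad v i‖)) ?_ ?_ v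
  -- The `L⁴` norm is not continuous for `L²` convergence, but it is lower semicontinuous: pass to
  -- an almost everywhere convergent subsequence and apply Fatou's lemma.
  · refine IsSeqClosed.isClosed fun vk v hk hlim => ?_
    have h1 : Tendsto (fun k => Sobolev.fn (vk k)) atTop (𝓝 (Sobolev.fn v)) :=
      ((fnL (m := 2) (Ω := Ω)).continuous.tendsto v).comp hlim
    obtain ⟨ns, hns, hae⟩ := (tendstoInMeasure_of_tendsto_Lp h1).exists_seq_tendsto_ae
    refine (Lp.eLpNorm_lim_le_liminf_eLpNorm
      (fun k => (Lp.memLp (Sobolev.fn (vk (ns k)))).1) _ hae).trans ?_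
    have h2 : Tendsto (fun k => ENNReal.ofReal (C.toReal * ∑ i, ‖Sobolev.grad (vk (ns k)) i‖)) atTop
        (𝓝 (ENNReal.ofReal (C.toReal * ∑ i, ‖Sobolev.grad v i‖))) := by
      have hcont : Continuous fun v : Sobolev Ω 2 =>
          ENNReal.ofReal (C.toReal * ∑ i, ‖Sobolev.grad v i‖) := by
        simp only [← gradL_apply]
        refine ENNReal.continuous_ofReal.comp ?_
        fun_prop
      exact (hcont.tendsto v).comp (hlim.comp hns.tendsto_atTop)
    rw [← h2.liminf_eq]
    exact liminf_le_liminf (Eventually.of_forall fun k => hk (ns k))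
  · intro u φ hφ
    have e1 : eLpNorm (Sobolev.fn u) 4 (volume.restrict (Ω : Set (EuclideanSpace ℝ (Fin n)))) =
        eLpNorm φ 4 (volume.restrict (Ω : Set (EuclideanSpace ℝ (Fin n)))) := by
      rw [hφ]
      exact eLpNorm_congr_ae (coeFn_testL2 φ)
    rw [e1, ENNReal.ofReal_mul ENNReal.toReal_nonneg, ENNReal.ofReal_toReal hC,
      ENNReal.ofReal_sum_of_nonneg fun i _ => norm_nonneg _]
    refine (h φ).trans (mul_le_mul_right ((eLpNorm_fderiv_test_le φ).trans_eq ?_) C)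
    refine Finset.sum_congr rfl fun i _ => ?_
    rw [grad_eq_testL2 hφ, ← eLpNorm_coe_L2]
    exact (eLpNorm_congr_ae (coeFn_testL2 _)).symm

end Rosenau

end

noncomputable section

namespace Rosenau

open Filter Topology
open scoped RealInnerProductSpace

variable {n : ℕ} {Ω : Opens (EuclideanSpace ℝ (Fin n))}

instance : Fact ((1 : ℝ≥0∞) ≤ 4) := ⟨by norm_num⟩

instance : NormedSpace ℝ (Sobolev Ω 2) := Submodule.normedSpace _

instance : NormedSpace ℝ (H02 Ω) := Submodule.normedSpace _

theorem mem_H02_of_test {u : Sobolev Ω 2} {φ : 𝓓(Ω, ℝ)} (h : Sobolev.fn u = testL2 φ) :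
    u ∈ H02 Ω := by
  refine Submodule.le_topologicalClosure _ (Submodule.subset_span ⟨φ, ?_⟩)
  rw [h]
  exact coeFn_testL2 φ

theorem isClosed_H02 : IsClosed (H02 Ω : Set (Sobolev Ω 2)) :=
  Submodule.isClosed_topologicalClosure _

theorem H02_induction_subtype {p : H02 Ω → Prop} (hc : IsClosed {u | p u})
    (ht : ∀ (u : H02 Ω) (φ : 𝓓(Ω, ℝ)), Sobolev.fn (u : Sobolev Ω 2) = testL2 φ → p u)
    (u : H02 Ω) : p u := by
  have h : ∃ h : (u : Sobolev Ω 2) ∈ H02 Ω, p ⟨u, h⟩ := by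
    refine H02_induction (p := fun v => ∃ h : v ∈ H02 Ω, p ⟨v, h⟩) ?_
      (fun v φ hφ => ⟨mem_H02_of_test hφ, ht _ φ hφ⟩) u
    have := isClosed_H02.isClosedEmbedding_subtypeVal.isClosedMap _ hc
    convert! this using 1
    ext v
    simp
  exact h.2

/-! ### The energy inner product on `H²₀(Ω)` -/

/-- The isometric embedding of `H²₀(Ω)`, with the energy norm `(‖v‖² + ‖Δv‖²)^{1/2}`, into
`L²(Ω) × L²(Ω)`. -/
def energyMap : H02 Ω →L[ℝ] WithLp 2 (L2 Ω × L2 Ω) :=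
  (WithLp.prodContinuousLinearEquiv 2 ℝ (L2 Ω) (L2 Ω)).symm.toContinuousLinearMap.comp
    ((fnL.prod lapL).comp (H02 Ω).subtypeL)

theorem inner_energyMap (v χ : H02 Ω) :
    ⟪energyMap v, energyMap χ⟫ =
      ⟪Sobolev.fn (v : Sobolev Ω 2), Sobolev.fn (χ : Sobolev Ω 2)⟫ +
        ⟪Sobolev.lap (v : Sobolev Ω 2), Sobolev.lap (χ : Sobolev Ω 2)⟫ := by
  rw [WithLp.prod_inner_apply]
  simp only [← lapL_apply]
  rfl

theorem norm_energyMap_sq (v : H02 Ω) :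
    ‖energyMap v‖ ^ 2 =
      ‖Sobolev.fn (v : Sobolev Ω 2)‖ ^ 2 + ‖Sobolev.lap (v : Sobolev Ω 2)‖ ^ 2 := by
  rw [← real_inner_self_eq_norm_sq, inner_energyMap, real_inner_self_eq_norm_sq,
    real_inner_self_eq_norm_sq]

theorem H02.ext_fn {u v : H02 Ω} (h : Sobolev.fn (u : Sobolev Ω 2) = Sobolev.fn (v : Sobolev Ω 2)) :
    u = v :=
  Subtype.ext (fnL_injective h)

theorem norm_fn_le (v : H02 Ω) : ‖Sobolev.fn (v : Sobolev Ω 2)‖ ≤ ‖energyMap v‖ := by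
  refine le_of_sq_le_sq ?_ (norm_nonneg _)
  rw [norm_energyMap_sq]
  linarith [sq_nonneg ‖Sobolev.lap (v : Sobolev Ω 2)‖]

/-- Green's formula with both arguments equal to `v`, then `2ab ≤ a² + b²`. -/
theorem sum_norm_grad_sq_le (v : H02 Ω) :
    ∑ i, ‖Sobolev.grad (v : Sobolev Ω 2) i‖ ^ 2 ≤ ‖energyMap v‖ ^ 2 / 2 := by
  have h := sum_inner_grad_eq (v : Sobolev Ω 2) v
  simp only [real_inner_self_eq_norm_sq] at h
  rw [h, norm_energyMap_sq]
  have h1 := abs_real_inner_le_norm (Sobolev.lap (v : Sobolev Ω 2)) (Sobolev.fn (v : Sobolev Ω 2))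
  have h2 := neg_abs_le ⟪Sobolev.lap (v : Sobolev Ω 2), Sobolev.fn (v : Sobolev Ω 2)⟫
  nlinarith [sq_nonneg (‖Sobolev.fn (v : Sobolev Ω 2)‖ - ‖Sobolev.lap (v : Sobolev Ω 2)‖)]

theorem norm_grad_le (v : H02 Ω) (i : Fin n) :
    ‖Sobolev.grad (v : Sobolev Ω 2) i‖ ≤ ‖energyMap v‖ := by
  refine le_of_sq_le_sq ?_ (norm_nonneg _)
  have h := Finset.single_le_sum (f := fun i => ‖Sobolev.grad (v : Sobolev Ω 2) i‖ ^ 2)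
    (fun i _ => sq_nonneg _) (Finset.mem_univ i)
  have := sum_norm_grad_sq_le v
  have h0 := sq_nonneg ‖energyMap v‖
  linarith

theorem norm2_sq_le (v : H02 Ω) : Sobolev.norm2 (v : Sobolev Ω 2) ^ 2 ≤ 2 * ‖energyMap v‖ ^ 2 := by
  rw [Sobolev.norm2, Real.sq_sqrt (by positivity)]
  have := sum_norm_grad_sq_le v
  have h := norm_energyMap_sq v
  linarith [sq_nonneg ‖energyMap v‖]

theorem norm_energyMap_le_norm2 (v : H02 Ω) :
    ‖energyMap v‖ ≤ Sobolev.norm2 (v : Sobolev Ω 2) := by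
  refine Real.le_sqrt_of_sq_le ?_
  rw [norm_energyMap_sq]
  linarith [Finset.sum_nonneg fun i (_ : i ∈ Finset.univ) =>
    sq_nonneg ‖Sobolev.grad (v : Sobolev Ω 2) i‖]

/-! ### The nonlinear term -/

/-- `J` is the inclusion `H²₀(Ω) ⊆ L⁴(Ω)`. -/
def IsInclusion
    (J : H02 Ω →L[ℝ] Lp ℝ 4 (volume.restrict (Ω : Set (EuclideanSpace ℝ (Fin n))))) : Prop :=
  ∀ v, J v =ᵐ[volume.restrict (Ω : Set (EuclideanSpace ℝ (Fin n)))]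
    Sobolev.fn (v : Sobolev Ω 2)

theorem norm_jet_le (v : H02 Ω) (w : JetIndex n 2) : ‖(v : Sobolev Ω 2).1 w‖ ≤ ‖v‖ :=
  PiLp.norm_apply_le (v : Sobolev Ω 2).1 w

theorem norm_energyMap_le (v : H02 Ω) : ‖energyMap v‖ ≤ (1 + n) * ‖v‖ := by
  have h1 : ‖Sobolev.fn (v : Sobolev Ω 2)‖ ≤ ‖v‖ := norm_jet_le v _
  have h2 : ‖Sobolev.lap (v : Sobolev Ω 2)‖ ≤ n * ‖v‖ := by
    refine (norm_sum_le _ _).trans ((Finset.sum_le_sum fun i _ => norm_jet_le v _).trans_eq ?_)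
    simp
  have h0 : 0 ≤ ‖v‖ := norm_nonneg v
  have hn : (0 : ℝ) ≤ n := Nat.cast_nonneg n
  refine le_of_sq_le_sq ?_ (by positivity)
  rw [norm_energyMap_sq]
  calc _ ≤ ‖v‖ ^ 2 + (n * ‖v‖) ^ 2 := by gcongr
    _ ≤ _ := by nlinarith [mul_nonneg hn (sq_nonneg ‖v‖)]

/-- The inclusion `H²₀(Ω) ⊆ L⁴(Ω)` as a linear map. -/
def inclusionL4 (hm : ∀ v : H02 Ω, MemLp (Sobolev.fn (v : Sobolev Ω 2)) 4
      (volume.restrict (Ω : Set (EuclideanSpace ℝ (Fin n))))) :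
    H02 Ω →ₗ[ℝ] Lp ℝ 4 (volume.restrict (Ω : Set (EuclideanSpace ℝ (Fin n)))) where
  toFun v := (hm v).toLp
  map_add' v w := by
    rw [← MemLp.toLp_add]
    exact MemLp.toLp_congr _ _ (Lp.coeFn_add _ _)
  map_smul' c v := by
    rw [RingHom.id_apply, ← MemLp.toLp_const_smul]
    exact MemLp.toLp_congr _ _ (Lp.coeFn_smul _ _)

theorem exists_L4_embedding (hn : 1 ≤ n) (hn2 : n ≤ 2)
    (hΩ : Bornology.IsBounded (Ω : Set (EuclideanSpace ℝ (Fin n)))) :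
    ∃ J : H02 Ω →L[ℝ] Lp ℝ 4 (volume.restrict (Ω : Set (EuclideanSpace ℝ (Fin n)))),
      IsInclusion J ∧ ∃ C : ℝ, 0 ≤ C ∧ ∀ v, ‖J v‖ ≤ C * ‖energyMap v‖ := by
  obtain ⟨C, hC, h⟩ := exists_eLpNorm_four_le hn hn2 hΩ
  have hm : ∀ v : H02 Ω, MemLp (Sobolev.fn (v : Sobolev Ω 2)) 4
      (volume.restrict (Ω : Set (EuclideanSpace ℝ (Fin n)))) := fun v =>
    ⟨(Lp.memLp _).1, (h v).trans_lt ENNReal.ofReal_lt_top⟩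
  have hJ : ∀ v, ‖inclusionL4 hm v‖ ≤ C * n * ‖energyMap v‖ := by
    intro v
    have h1 : ‖inclusionL4 hm v‖ ≤ C * ∑ i, ‖Sobolev.grad (v : Sobolev Ω 2) i‖ := by
      rw [Lp.norm_def]
      refine ENNReal.toReal_le_of_le_ofReal (by positivity) ?_
      exact (eLpNorm_congr_ae (hm v).coeFn_toLp).trans_le (h v)
    have h2 : ∑ i, ‖Sobolev.grad (v : Sobolev Ω 2) i‖ ≤ n * ‖energyMap v‖ := by
      refine (Finset.sum_le_sum fun i _ => norm_grad_le v i).trans_eq ?_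
      simp
    calc _ ≤ _ := h1
      _ ≤ C * (n * ‖energyMap v‖) := by gcongr
      _ = _ := by ring
  refine ⟨(inclusionL4 hm).mkContinuous (C * n * (1 + n)) fun v => ?_,
    fun v => (hm v).coeFn_toLp, C * n, by positivity, hJ⟩
  rw [mul_assoc (C * n)]
  exact (hJ v).trans (mul_le_mul_of_nonneg_left (norm_energyMap_le v) (by positivity))

instance : ENNReal.HolderTriple 4 4 2 where
  inv_add_inv_eq_inv := by
    rw [← two_mul, show (4 : ℝ≥0∞) = 2 * 2 by norm_num,
      ENNReal.mul_inv (by norm_num) (by norm_num), ← mul_assoc,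
      ENNReal.mul_inv_cancel (by norm_num) (by norm_num), one_mul]

variable (Ω) in
/-- The pointwise product of two functions of `L⁴(Ω)`. -/
def mulL4 : Lp ℝ 4 (volume.restrict (Ω : Set (EuclideanSpace ℝ (Fin n)))) →L[ℝ]
    Lp ℝ 4 (volume.restrict (Ω : Set (EuclideanSpace ℝ (Fin n)))) →L[ℝ] L2 Ω :=
  (ContinuousLinearMap.mul ℝ ℝ).holderL
    (volume.restrict (Ω : Set (EuclideanSpace ℝ (Fin n)))) 4 4 2

theorem coeFn_mulL4
    (f g : Lp ℝ 4 (volume.restrict (Ω : Set (EuclideanSpace ℝ (Fin n))))) :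
    mulL4 Ω f g =ᵐ[volume.restrict (Ω : Set (EuclideanSpace ℝ (Fin n)))] fun x => f x * g x :=
  (ContinuousLinearMap.mul ℝ ℝ).coeFn_holder (r := 2) f g

theorem norm_mulL4_le
    (f g : Lp ℝ 4 (volume.restrict (Ω : Set (EuclideanSpace ℝ (Fin n))))) :
    ‖mulL4 Ω f g‖ ≤ ‖f‖ * ‖g‖ := by
  refine ((ContinuousLinearMap.mul ℝ ℝ).norm_holder_apply_apply_le (r := 2) f g).trans ?_
  have h2 : ‖ContinuousLinearMap.mul ℝ ℝ‖ ≤ 1 := ContinuousLinearMap.opNorm_mul_le ℝ ℝ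
  calc _ ≤ 1 * ‖f‖ * ‖g‖ := by gcongr
    _ = _ := by rw [one_mul]

theorem mulL4_comm
    (f g : Lp ℝ 4 (volume.restrict (Ω : Set (EuclideanSpace ℝ (Fin n))))) :
    mulL4 Ω f g = mulL4 Ω g f := by
  refine Lp.ext ?_
  filter_upwards [coeFn_mulL4 f g, coeFn_mulL4 g f] with x h1 h2
  rw [h1, h2, mul_comm]

theorem IsInclusion.coeFn_mulL4
    {J : H02 Ω →L[ℝ] Lp ℝ 4 (volume.restrict (Ω : Set (EuclideanSpace ℝ (Fin n))))}
    (hJ : IsInclusion J) (v w : H02 Ω) :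
    mulL4 Ω (J v) (J w) =ᵐ[volume.restrict (Ω : Set (EuclideanSpace ℝ (Fin n)))]
      fun x => Sobolev.fn (v : Sobolev Ω 2) x * Sobolev.fn (w : Sobolev Ω 2) x := by
  filter_upwards [Rosenau.coeFn_mulL4 (J v) (J w), hJ v, hJ w] with x h1 h2 h3
  rw [← h2, ← h3, h1]

/-- The sum of the first partial derivatives. -/
def sumGrad : H02 Ω →L[ℝ] L2 Ω := (∑ i, gradL i).comp (H02 Ω).subtypeL

theorem sumGrad_apply (v : H02 Ω) : sumGrad v = ∑ i, Sobolev.grad (v : Sobolev Ω 2) i := by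
  simp [sumGrad, gradL_apply]

theorem norm_sumGrad_le (v : H02 Ω) : ‖sumGrad v‖ ≤ n * ‖energyMap v‖ := by
  rw [sumGrad_apply]
  refine (norm_sum_le _ _).trans ((Finset.sum_le_sum fun i _ => norm_grad_le v i).trans_eq ?_)
  simp

theorem abs_sum_inner_grad_le (v χ : H02 Ω) :
    |∑ i, ⟪Sobolev.grad (v : Sobolev Ω 2) i, Sobolev.grad (χ : Sobolev Ω 2) i⟫| ≤
      n * (‖energyMap v‖ * ‖energyMap χ‖) := by
  refine (Finset.abs_sum_le_sum_abs _ _).trans ?_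
  refine (Finset.sum_le_sum (g := fun _ => ‖energyMap v‖ * ‖energyMap χ‖) fun i _ => ?_).trans_eq ?_
  · refine (abs_real_inner_le_norm _ _).trans ?_
    gcongr
    exacts [norm_grad_le v i, norm_grad_le χ i]
  · simp

/-- For a test function, `φ² ∂φ` is a third of the derivative of `φ³`. This removes the cubic term
of the error equation, the only one that could not be absorbed without a bound on `uh`. -/
theorem inner_product_self_grad {J : H02 Ω →L[ℝ] Lp ℝ 4 (volume.restrict (Ω : Set (EuclideanSpace ℝ (Fin n))))}
    (hJ : IsInclusion J)
    (v : H02 Ω) (i : Fin n) :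
    ⟪mulL4 Ω (J v) (J v), Sobolev.grad (v : Sobolev Ω 2) i⟫ = 0 := by
  refine H02_induction_subtype (p := fun v => ⟪mulL4 Ω (J v) (J v), Sobolev.grad (v : Sobolev Ω 2) i⟫ = 0)
    ?_ ?_ v
  · simp only [← gradL_apply]
    exact isClosed_eq (by fun_prop) continuous_const
  · intro u φ hφ
    rw [grad_eq_testL2 hφ, inner_testL2]
    -- Integration by parts gives `I = -2I` for `I = ∫ φ² ∂φ`.
    have h1 := integral_mul_pderiv_test i (fun x => φ x ^ 2)
      ((φ.contDiff.of_le (by exact_mod_cast le_top)).pow 2) φ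
    have h2 : ∀ x, fderiv ℝ (fun x => φ x ^ 2) x (EuclideanSpace.single i 1) * φ x =
        2 * (φ x ^ 2 * pderivTest i φ x) := by
      intro x
      have hd : DifferentiableAt ℝ φ x := φ.contDiff.differentiable (by simp) x
      rw [fderiv_fun_pow 2 hd, pderivTest_apply]
      simp
      ring
    simp only [h2] at h1
    rw [integral_const_mul] at h1
    have h3 : ∫ x in (Ω : Set (EuclideanSpace ℝ (Fin n))), mulL4 Ω (J u) (J u) x * pderivTest i φ x =
        ∫ x in (Ω : Set (EuclideanSpace ℝ (Fin n))), φ x ^ 2 * pderivTest i φ x := by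
      apply integral_congr_ae
      filter_upwards [hJ.coeFn_mulL4 u u, coeFn_testL2 φ] with x h4 h5
      rw [h4, hφ, h5, sq]
    rw [h3]
    linarith

theorem inner_product_self_sumGrad {J : H02 Ω →L[ℝ] Lp ℝ 4 (volume.restrict (Ω : Set (EuclideanSpace ℝ (Fin n))))}
    (hJ : IsInclusion J)
    (v : H02 Ω) : ⟪mulL4 Ω (J v) (J v), sumGrad v⟫ = 0 := by
  rw [sumGrad_apply, inner_sum]
  exact Finset.sum_eq_zero fun i _ => inner_product_self_grad hJ v i

/-- All components of `flux` coincide, so pairing with the gradient of `χ` only sees the sum of its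
partial derivatives; the minus signs cancel. -/
theorem inner_flux_eq {J : H02 Ω →L[ℝ] Lp ℝ 4 (volume.restrict (Ω : Set (EuclideanSpace ℝ (Fin n))))}
    (hJ : IsInclusion J)
    (v χ : H02 Ω) :
    ⟪Sobolev.fn (v : Sobolev Ω 2) + (1 / 2 : ℝ) • mulL4 Ω (J v) (J v), sumGrad χ⟫ =
      -∫ x in (Ω : Set (EuclideanSpace ℝ (Fin n))),
        ∑ i, flux n (Sobolev.fn (v : Sobolev Ω 2) x) i *
          Sobolev.grad (χ : Sobolev Ω 2) i x := by
  rw [inner_L2_eq_integral, ← integral_neg]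
  apply integral_congr_ae
  have h3 : ∀ᵐ x ∂(volume.restrict (Ω : Set (EuclideanSpace ℝ (Fin n)))),
      sumGrad χ x = ∑ i, Sobolev.grad (χ : Sobolev Ω 2) i x := by
    rw [sumGrad_apply]
    filter_upwards [Lp.coeFn_finsetSum Finset.univ fun i => Sobolev.grad (χ : Sobolev Ω 2) i]
      with x hx
    rw [hx, Finset.sum_apply]
  filter_upwards [hJ.coeFn_mulL4 v v, Lp.coeFn_add (Sobolev.fn (v : Sobolev Ω 2)) ((1 / 2 : ℝ) • mulL4 Ω (J v) (J v)),
    Lp.coeFn_smul (1 / 2 : ℝ) (mulL4 Ω (J v) (J v)), h3] with x h0 h1 h2 h3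
  rw [h1, Pi.add_apply, h2, Pi.smul_apply, h0, h3, Finset.mul_sum, ← Finset.sum_neg_distrib]
  refine Finset.sum_congr rfl fun i _ => ?_
  rw [flux, smul_eq_mul]
  ring

/-- The divergence is defined against test functions only; the `L⁴` embedding puts the flux in `L²`,
so the identity passes to the closure `H02`. -/
theorem inner_weakDiv_eq {J : H02 Ω →L[ℝ] Lp ℝ 4 (volume.restrict (Ω : Set (EuclideanSpace ℝ (Fin n))))}
    (hJ : IsInclusion J)
    (v χ : H02 Ω) {d : L2 Ω}
    (hd : IsWeakDiv (fun x => flux n (Sobolev.fn (v : Sobolev Ω 2) x)) d) :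
    ⟪d, Sobolev.fn (χ : Sobolev Ω 2)⟫ =
      ⟪Sobolev.fn (v : Sobolev Ω 2) + (1 / 2 : ℝ) • mulL4 Ω (J v) (J v), sumGrad χ⟫ := by
  refine H02_induction_subtype (p := fun χ => ⟪d, Sobolev.fn (χ : Sobolev Ω 2)⟫ =
      ⟪Sobolev.fn (v : Sobolev Ω 2) + (1 / 2 : ℝ) • mulL4 Ω (J v) (J v), sumGrad χ⟫) ?_ ?_ χ
  · simp only [← fnL_apply]
    exact isClosed_eq (by fun_prop) (by fun_prop)
  · intro χ φ hφ
    rw [inner_flux_eq hJ, hφ, inner_testL2, ← neg_eq_iff_eq_neg, ← hd φ]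
    apply integral_congr_ae
    have h : ∀ᵐ x ∂(volume.restrict (Ω : Set (EuclideanSpace ℝ (Fin n)))),
        ∀ i, Sobolev.grad (χ : Sobolev Ω 2) i x = pderivTest i φ x := by
      rw [ae_all_iff]
      intro i
      rw [grad_eq_testL2 hφ]
      exact coeFn_testL2 _
    filter_upwards [h] with x hx
    refine Finset.sum_congr rfl fun i _ => ?_
    rw [hx, partialDeriv_single_eq]

end Rosenau

end

noncomputable section

namespace Rosenau

open Filter Topology
open scoped RealInnerProductSpace

/-! ### An abstract energy estimate for Galerkin approximations -/

section abstract

variable {V Y : Type*} [AddCommGroup V] [Module ℝ V] [NormedAddCommGroup Y]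
  [InnerProductSpace ℝ Y]

/-- A finite-dimensional subspace has a finite family which is orthonormal and total for the inner
product pulled back along a linear map. -/
theorem exists_orthonormal_total (Λ : V →ₗ[ℝ] Y) (S : Submodule ℝ V) [FiniteDimensional ℝ S] :
    ∃ (d : ℕ) (χ : Fin d → V), (∀ k, χ k ∈ S) ∧ Orthonormal ℝ (fun k => Λ (χ k)) ∧
      ∀ φ ∈ S, Λ φ = ∑ k, ⟪Λ (χ k), Λ φ⟫ • Λ (χ k) := by
  -- The basis is chosen in the image of `S` and lifted, so `Λ` need not be injective.
  let b := stdOrthonormalBasis ℝ (S.map Λ)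
  have hb : ∀ k, ∃ χ ∈ S, Λ χ = b k := fun k => Submodule.mem_map.1 (b k).2
  choose χ hχS hχ using hb
  refine ⟨_, χ, hχS, ?_, fun φ hφ => ?_⟩
  · simp only [hχ]
    exact b.orthonormal.comp_linearIsometry (S.map Λ).subtypeₗᵢ
  · simp only [hχ]
    have := congrArg Subtype.val (b.sum_repr' ⟨Λ φ, Submodule.mem_map_of_mem hφ⟩)
    simpa using this.symm

theorem norm_sum_smul_sq_of_orthonormal {d : ℕ} {e : Fin d → Y} (he : Orthonormal ℝ e)
    (c : Fin d → ℝ) : ‖∑ k, c k • e k‖ ^ 2 = ∑ k, c k ^ 2 := by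
  rw [← real_inner_self_eq_norm_sq, he.inner_sum]
  simp [sq]

/-- Grönwall's inequality: `exp(-Dt)(y + E)` has nonpositive derivative on the open interval and is
continuous up to the endpoints. -/
theorem add_le_exp_mul_of_deriv_le {y y' : ℝ → ℝ} {T D E : ℝ}
    (hc : ContinuousOn y (Icc 0 T)) (hd : ∀ t ∈ Ioo 0 T, HasDerivAt y (y' t) t)
    (hy : ∀ t ∈ Ioo 0 T, y' t ≤ D * (y t + E)) {t : ℝ} (ht : t ∈ Icc 0 T) :
    y t + E ≤ Real.exp (D * t) * (y 0 + E) := by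
  have hd' : ∀ t ∈ Ioo 0 T, HasDerivAt (fun t => Real.exp (-(D * t)) * (y t + E))
      (Real.exp (-(D * t)) * (y' t - D * (y t + E))) t := by
    intro t ht
    have h1 : HasDerivAt (fun t => Real.exp (-(D * t))) (Real.exp (-(D * t)) * -(D * 1)) t :=
      (((hasDerivAt_id t).const_mul D).neg).exp
    refine (h1.mul ((hd t ht).add_const E)).congr_deriv ?_
    ring
  have hanti : AntitoneOn (fun t => Real.exp (-(D * t)) * (y t + E)) (Icc 0 T) := by
    refine antitoneOn_of_deriv_nonpos (convex_Icc 0 T) ?_ ?_ ?_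
    · exact ContinuousOn.mul (by fun_prop) (hc.add continuousOn_const)
    · rw [interior_Icc]
      exact fun t ht => (hd' t ht).differentiableAt.differentiableWithinAt
    · rw [interior_Icc]
      intro t ht
      rw [(hd' t ht).deriv]
      exact mul_nonpos_of_nonneg_of_nonpos (Real.exp_nonneg _) (sub_nonpos.2 (hy t ht))
  have h := hanti (left_mem_Icc.2 (ht.1.trans ht.2)) ht ht.1
  simp only [mul_zero, neg_zero, Real.exp_zero, one_mul] at h
  calc y t + E = Real.exp (D * t) * (Real.exp (-(D * t)) * (y t + E)) := by
        rw [← mul_assoc, ← Real.exp_add, add_neg_cancel, Real.exp_zero, one_mul]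
    _ ≤ _ := by gcongr

/-- If `⟨Λ u, Λ χ⟩' = Φ(u, χ)` for all `χ` in `S`, both for the exact solution `U` and
for the approximate solution `uh` in `S`, then the energy norm of the error is controlled by that of
the initial error and the best approximation error. -/
theorem norm_sq_sub_le_of_galerkin {Λ : V →ₗ[ℝ] Y} {Φ : V → V → ℝ} {T D M ε : ℝ}
    {S : Submodule ℝ V} [FiniteDimensional ℝ S] {U uh : ℝ → V} (hD : 0 ≤ D)
    (hΦs : ∀ v (d : ℕ) (c : Fin d → ℝ) (χ : Fin d → V),
      Φ v (∑ k, c k • χ k) = ∑ k, c k * Φ v (χ k))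
    (hΦ : ∀ v ρ θ, ‖Λ v‖ ≤ M → ‖Λ ρ‖ ≤ M →
      Φ v θ - Φ (v - ρ - θ) θ ≤ D * (‖Λ ρ‖ ^ 2 + ‖Λ θ‖ ^ 2))
    (hUM : ∀ t ∈ Ioo 0 T, ‖Λ (U t)‖ ≤ M)
    (hε : ∀ t ∈ Ioo 0 T, ∀ c, (∀ φ ∈ S, c ≤ ‖Λ (U t - φ)‖) → c ≤ ε)
    (huh : ∀ t, uh t ∈ S)
    (hUc : ∀ χ ∈ S, ContinuousOn (fun t => ⟪Λ (U t), Λ χ⟫) (Icc 0 T))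
    (huc : ∀ χ ∈ S, ContinuousOn (fun t => ⟪Λ (uh t), Λ χ⟫) (Icc 0 T))
    (hUd : ∀ χ ∈ S, ∀ t ∈ Ioo 0 T, HasDerivAt (fun t => ⟪Λ (U t), Λ χ⟫) (Φ (U t) χ) t)
    (hud : ∀ χ ∈ S, ∀ t ∈ Ioo 0 T, HasDerivAt (fun t => ⟪Λ (uh t), Λ χ⟫) (Φ (uh t) χ) t)
    {t : ℝ} (ht : t ∈ Ioo 0 T) :
    ‖Λ (U t - uh t)‖ ^ 2 ≤ Real.exp (2 * D * T) * (‖Λ (U 0 - uh 0)‖ ^ 2 + ε ^ 2) := by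
  obtain ⟨d, χ, hχS, hχ, htot⟩ := exists_orthonormal_total Λ S
  -- The coefficients of the projection of the error on `S`. Only these finitely many scalar
  -- functions are ever differentiated.
  let c : Fin d → ℝ → ℝ := fun k t => ⟪Λ (U t), Λ (χ k)⟫ - ⟪Λ (uh t), Λ (χ k)⟫
  let θ : ℝ → V := fun t => ∑ k, c k t • χ k
  let ρ : ℝ → V := fun t => U t - uh t - θ t
  have hθS : ∀ t, θ t ∈ S := fun t => S.sum_mem fun k _ => S.smul_mem _ (hχS k)
  have hθ : ∀ t, ‖Λ (θ t)‖ ^ 2 = ∑ k, c k t ^ 2 := by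
    intro t
    simp only [θ, map_sum, map_smul]
    exact norm_sum_smul_sq_of_orthonormal hχ _
  have horth : ∀ t, ∀ φ ∈ S, ⟪Λ (ρ t), Λ φ⟫ = 0 := by
    intro t φ hφ
    rw [htot φ hφ, inner_sum]
    refine Finset.sum_eq_zero fun k _ => ?_
    have : ⟪Λ (θ t), Λ (χ k)⟫ = c k t := by
      simp only [θ, map_sum, map_smul]
      rw [real_inner_comm]
      exact hχ.inner_right_fintype _ _
    rw [inner_smul_right]
    simp only [ρ, map_sub, inner_sub_left, this, c]
    ring
  have hpyth : ∀ t, ∀ φ ∈ S, ‖Λ (ρ t + φ)‖ ^ 2 = ‖Λ (ρ t)‖ ^ 2 + ‖Λ φ‖ ^ 2 := by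
    intro t φ hφ
    rw [map_add, norm_add_sq_real, horth t φ hφ]
    ring
  have hbest : ∀ t, ∀ φ ∈ S, ‖Λ (ρ t)‖ ≤ ‖Λ (U t - φ)‖ := by
    intro t φ hφ
    have h1 := hpyth t (uh t + θ t - φ) (S.sub_mem (S.add_mem (huh t) (hθS t)) hφ)
    have h2 : ρ t + (uh t + θ t - φ) = U t - φ := by
      simp only [ρ]
      abel
    rw [h2] at h1
    refine le_of_sq_le_sq ?_ (norm_nonneg _)
    rw [h1]
    linarith [sq_nonneg ‖Λ (uh t + θ t - φ)‖]
  -- The norm of `ρ` is a lower bound for all distances from `U t` to points of `S`, which is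
  -- exactly what `hε` accepts; no minimiser is required.
  have hρε : ∀ t ∈ Ioo 0 T, ‖Λ (ρ t)‖ ≤ ε := fun t ht => hε t ht _ (hbest t)
  -- Comparison with the approximant `0`.
  have hρM : ∀ t ∈ Ioo 0 T, ‖Λ (ρ t)‖ ≤ M := fun t ht => by
    refine (hbest t 0 S.zero_mem).trans ?_
    rw [sub_zero]
    exact hUM t ht
  have hsplit : ∀ t, ‖Λ (U t - uh t)‖ ^ 2 = ‖Λ (ρ t)‖ ^ 2 + ∑ k, c k t ^ 2 := by
    intro t
    rw [← hθ, ← hpyth t _ (hθS t)]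
    simp [ρ]
  have hcc : ContinuousOn (fun t => ∑ k, c k t ^ 2) (Icc 0 T) :=
    continuousOn_finsetSum _ fun k _ => ((hUc _ (hχS k)).sub (huc _ (hχS k))).pow 2
  have hcd : ∀ t ∈ Ioo 0 T, HasDerivAt (fun t => ∑ k, c k t ^ 2)
      (2 * (Φ (U t) (θ t) - Φ (uh t) (θ t))) t := by
    intro t ht
    have h1 : ∀ k ∈ Finset.univ, HasDerivAt (fun t => c k t ^ 2)
        (2 * c k t * (Φ (U t) (χ k) - Φ (uh t) (χ k))) t := fun k _ => by
      exact (((hUd _ (hχS k) t ht).sub (hud _ (hχS k) t ht)).pow 2).congr_deriv (by simp [c])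
    refine (HasDerivAt.fun_sum h1).congr_deriv ?_
    simp only [θ, hΦs]
    rw [← Finset.sum_sub_distrib, Finset.mul_sum]
    exact Finset.sum_congr rfl fun k _ => by ring
  have hineq : ∀ t ∈ Ioo 0 T, 2 * (Φ (U t) (θ t) - Φ (uh t) (θ t)) ≤
      2 * D * (∑ k, c k t ^ 2 + ε ^ 2) := by
    intro t ht
    have h1 := hΦ (U t) (ρ t) (θ t) (hUM t ht) (hρM t ht)
    have h2 : U t - ρ t - θ t = uh t := by
      simp only [ρ]
      abel
    rw [h2, hθ] at h1
    have h3 : ‖Λ (ρ t)‖ ^ 2 ≤ ε ^ 2 := by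
      gcongr
      exact hρε t ht
    nlinarith [mul_le_mul_of_nonneg_left h3 hD]
  have hmain := add_le_exp_mul_of_deriv_le hcc hcd hineq (Ioo_subset_Icc_self ht)
  have h0 : ∑ k, c k 0 ^ 2 ≤ ‖Λ (U 0 - uh 0)‖ ^ 2 := by
    rw [hsplit 0]
    linarith [sq_nonneg ‖Λ (ρ 0)‖]
  have h3 : ‖Λ (ρ t)‖ ^ 2 ≤ ε ^ 2 := by
    gcongr
    exact hρε t ht
  have hexp : Real.exp (2 * D * t) ≤ Real.exp (2 * D * T) :=
    Real.exp_le_exp.2 (mul_le_mul_of_nonneg_left ht.2.le (by positivity))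
  have hnn : 0 ≤ ∑ k, c k 0 ^ 2 := Finset.sum_nonneg fun k _ => sq_nonneg _
  rw [hsplit t]
  calc _ ≤ ∑ k, c k t ^ 2 + ε ^ 2 := by linarith
    _ ≤ _ := hmain
    _ ≤ _ := by gcongr

/-- The increment of a quadratic map between `a` and `a - b - c`, where `h` cancels the term
quadratic in `c` alone; every surviving quadratic term contains `a` or `b`. -/
theorem inner_add_half_quadratic_sub {W : Type*} [NormedAddCommGroup W] [NormedSpace ℝ W]
    (B : W →L[ℝ] W →L[ℝ] Y) (hB : ∀ a b, B a b = B b a) (a b c : W) (x y z s : Y)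
    (h : ⟪B c c, s⟫ = 0) :
    ⟪x + (1 / 2 : ℝ) • B a a, s⟫ -
        ⟪(x - y - z) + (1 / 2 : ℝ) • B (a - b - c) (a - b - c), s⟫ =
      ⟪y, s⟫ + ⟪z, s⟫ + ⟪B a b, s⟫ + ⟪B a c, s⟫ - ⟪B b b, s⟫ / 2 - ⟪B b c, s⟫ := by
  simp only [map_sub, sub_apply, inner_sub_left, inner_add_left,
    real_inner_smul_left, hB b a, hB c a, hB c b, h]
  ring

theorem sum_inner_sub_sub {ι : Type*} [Fintype ι] (x y z s : ι → Y) :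
    ∑ i, ⟪x i, s i⟫ - ∑ i, ⟪x i - y i - z i, s i⟫ =
      ∑ i, ⟪y i, s i⟫ + ∑ i, ⟪z i, s i⟫ := by
  simp only [inner_sub_left, Finset.sum_sub_distrib]
  ring

end abstract

/-- Here `w`, `a`, `t` stand for the energy norms of `v`, `ρ`, `θ`. Bounding one factor `w` or `a`
by `M` in each `q` leaves `3/2` times `M a t` and `2` times `M t²`, whence the `2` before `N * C ^ 2
* M`; then `(a + t)t ≤ 2(a² + t²)`. -/
theorem galerkin_bound {α N C M a t w g₁ g₂ l₁ l₂ q₁ q₂ q₃ q₄ : ℝ} (hα : 0 < α) (hN : 0 ≤ N)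
    (hM : 0 ≤ M) (ha0 : 0 ≤ a) (ht0 : 0 ≤ t) (hw : w ≤ M) (ha : a ≤ M)
    (h₁ : |g₁| ≤ N * (a * t)) (h₂ : |g₂| ≤ N * (t * t)) (h₃ : |l₁| ≤ N * (a * t))
    (h₄ : |l₂| ≤ N * (t * t)) (h₅ : |q₁| ≤ C ^ 2 * N * (w * a) * t)
    (h₆ : |q₂| ≤ C ^ 2 * N * (w * t) * t) (h₇ : |q₃| ≤ C ^ 2 * N * (a * a) * t)
    (h₈ : |q₄| ≤ C ^ 2 * N * (a * t) * t) :
    -(α * (g₁ + g₂)) + (l₁ + l₂ + q₁ + q₂ - q₃ / 2 - q₄) ≤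
      2 * (α * N + N + 2 * N * C ^ 2 * M) * (a ^ 2 + t ^ 2) := by
  have b1 := mul_le_mul_of_nonneg_left (neg_le_of_abs_le h₁) hα.le
  have b2 := mul_le_mul_of_nonneg_left (neg_le_of_abs_le h₂) hα.le
  have b3 := le_of_abs_le h₃
  have b4 := le_of_abs_le h₄
  have b5 := le_of_abs_le h₅
  have b6 := le_of_abs_le h₆
  have b7 := neg_le_of_abs_le h₇
  have b8 := neg_le_of_abs_le h₈
  have c5 : C ^ 2 * N * (w * a) * t ≤ C ^ 2 * N * (M * a) * t := by gcongr
  have c6 : C ^ 2 * N * (w * t) * t ≤ C ^ 2 * N * (M * t) * t := by gcongr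
  have c7 : C ^ 2 * N * (a * a) * t ≤ C ^ 2 * N * (M * a) * t := by gcongr
  have c8 : C ^ 2 * N * (a * t) * t ≤ C ^ 2 * N * (M * t) * t := by gcongr
  have p : 0 ≤ C ^ 2 * N * (M * a) * t := by positivity
  have hat : (a + t) * t ≤ 2 * (a ^ 2 + t ^ 2) := by nlinarith [sq_nonneg (a - t)]
  have hfin : (α * N + N + 2 * N * C ^ 2 * M) * ((a + t) * t) ≤
      (α * N + N + 2 * N * C ^ 2 * M) * (2 * (a ^ 2 + t ^ 2)) := by gcongr
  linarith

/-! ### The form of the Rosenau equation -/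

variable {n : ℕ} {Ω : Opens (EuclideanSpace ℝ (Fin n))}

/-- The form `χ ↦ -α (∇v, ∇χ) - (g(v), ∇χ)` on `H²₀(Ω)`. -/
def rosenauForm (α : ℝ)
    (J : H02 Ω →L[ℝ] Lp ℝ 4 (volume.restrict (Ω : Set (EuclideanSpace ℝ (Fin n)))))
    (v χ : H02 Ω) : ℝ :=
  -(α * ∑ i, ⟪Sobolev.grad (v : Sobolev Ω 2) i, Sobolev.grad (χ : Sobolev Ω 2) i⟫) +
    ⟪Sobolev.fn (v : Sobolev Ω 2) + (1 / 2 : ℝ) • mulL4 Ω (J v) (J v), sumGrad χ⟫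

/-- The `i`-th component of the gradient on `H²₀(Ω)`. -/
def gradH (i : Fin n) : H02 Ω →L[ℝ] L2 Ω := (gradL i).comp (H02 Ω).subtypeL

theorem gradH_apply (i : Fin n) (v : H02 Ω) : gradH i v = Sobolev.grad (v : Sobolev Ω 2) i := rfl

theorem gradH_sum_smul (i : Fin n) {d : ℕ} (c : Fin d → ℝ) (χ : Fin d → H02 Ω) :
    gradH i (∑ k, c k • χ k) = ∑ k, c k • gradH i (χ k) := by
  rw [map_sum]
  exact Finset.sum_congr rfl fun k _ => map_smul _ _ _

theorem sumGrad_sum_smul {d : ℕ} (c : Fin d → ℝ) (χ : Fin d → H02 Ω) :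
    sumGrad (∑ k, c k • χ k) = ∑ k, c k • sumGrad (χ k) := by
  rw [map_sum]
  exact Finset.sum_congr rfl fun k _ => map_smul _ _ _

theorem rosenauForm_sum_smul (α : ℝ)
    (J : H02 Ω →L[ℝ] Lp ℝ 4 (volume.restrict (Ω : Set (EuclideanSpace ℝ (Fin n)))))
    (v : H02 Ω) (d : ℕ) (c : Fin d → ℝ) (χ : Fin d → H02 Ω) :
    rosenauForm α J v (∑ k, c k • χ k) = ∑ k, c k * rosenauForm α J v (χ k) := by
  simp only [rosenauForm, ← gradH_apply, gradH_sum_smul, sumGrad_sum_smul, inner_sum,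
    inner_smul_right]
  rw [Finset.sum_comm]
  simp only [← Finset.mul_sum]
  rw [Finset.mul_sum, ← Finset.sum_neg_distrib, ← Finset.sum_add_distrib]
  exact Finset.sum_congr rfl fun k _ => by ring

theorem continuous_rosenauForm (α : ℝ)
    (J : H02 Ω →L[ℝ] Lp ℝ 4 (volume.restrict (Ω : Set (EuclideanSpace ℝ (Fin n)))))
    (χ : H02 Ω) : Continuous fun v => rosenauForm α J v χ := by
  simp only [rosenauForm, ← gradL_apply, ← fnL_apply]
  fun_prop

theorem map_sub_sub_L4
    (J : H02 Ω →L[ℝ] Lp ℝ 4 (volume.restrict (Ω : Set (EuclideanSpace ℝ (Fin n)))))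
    (v ρ θ : H02 Ω) : J (v - ρ - θ) = J v - J ρ - J θ :=
  (map_sub J (v - ρ) θ).trans (congrArg (· - J θ) (map_sub J v ρ))

theorem rosenauForm_sub_sub (α : ℝ)
    (J : H02 Ω →L[ℝ] Lp ℝ 4 (volume.restrict (Ω : Set (EuclideanSpace ℝ (Fin n)))))
    (v ρ θ χ : H02 Ω) :
    rosenauForm α J (v - ρ - θ) χ =
      -(α * ∑ i, ⟪Sobolev.grad (v : Sobolev Ω 2) i - Sobolev.grad (ρ : Sobolev Ω 2) i
        - Sobolev.grad (θ : Sobolev Ω 2) i, Sobolev.grad (χ : Sobolev Ω 2) i⟫) +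
      ⟪(Sobolev.fn (v : Sobolev Ω 2) - Sobolev.fn (ρ : Sobolev Ω 2)
        - Sobolev.fn (θ : Sobolev Ω 2)) +
          (1 / 2 : ℝ) • mulL4 Ω (J v - J ρ - J θ) (J v - J ρ - J θ), sumGrad χ⟫ := by
  rw [← map_sub_sub_L4 J v ρ θ]
  rfl

theorem rosenauForm_sub_eq {α : ℝ}
    {J : H02 Ω →L[ℝ] Lp ℝ 4 (volume.restrict (Ω : Set (EuclideanSpace ℝ (Fin n))))}
    (hJ : IsInclusion J) (v ρ θ : H02 Ω) :
    rosenauForm α J v θ - rosenauForm α J (v - ρ - θ) θ =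
      -(α * (∑ i, ⟪Sobolev.grad (ρ : Sobolev Ω 2) i, Sobolev.grad (θ : Sobolev Ω 2) i⟫ +
        ∑ i, ⟪Sobolev.grad (θ : Sobolev Ω 2) i, Sobolev.grad (θ : Sobolev Ω 2) i⟫)) +
      (⟪Sobolev.fn (ρ : Sobolev Ω 2), sumGrad θ⟫ + ⟪Sobolev.fn (θ : Sobolev Ω 2), sumGrad θ⟫
      + ⟪mulL4 Ω (J v) (J ρ), sumGrad θ⟫ + ⟪mulL4 Ω (J v) (J θ), sumGrad θ⟫
      - ⟪mulL4 Ω (J ρ) (J ρ), sumGrad θ⟫ / 2 - ⟪mulL4 Ω (J ρ) (J θ), sumGrad θ⟫) := by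
  have e4 := sum_inner_sub_sub (Sobolev.grad (v : Sobolev Ω 2)) (Sobolev.grad (ρ : Sobolev Ω 2))
    (Sobolev.grad (θ : Sobolev Ω 2)) (Sobolev.grad (θ : Sobolev Ω 2))
  have e5 := inner_add_half_quadratic_sub (mulL4 Ω) mulL4_comm (J v) (J ρ) (J θ)
    (Sobolev.fn (v : Sobolev Ω 2)) (Sobolev.fn (ρ : Sobolev Ω 2)) (Sobolev.fn (θ : Sobolev Ω 2))
    (sumGrad θ) (inner_product_self_sumGrad hJ θ)
  rw [rosenauForm_sub_sub, ← e5, rosenauForm]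
  linear_combination (-α) * e4

theorem abs_inner_mulL4_sumGrad_le
    {J : H02 Ω →L[ℝ] Lp ℝ 4 (volume.restrict (Ω : Set (EuclideanSpace ℝ (Fin n))))}
    {C : ℝ} (hC : 0 ≤ C) (hJC : ∀ v, ‖J v‖ ≤ C * ‖energyMap v‖) (f g θ : H02 Ω) :
    |⟪mulL4 Ω (J f) (J g), sumGrad θ⟫| ≤
      C ^ 2 * n * (‖energyMap f‖ * ‖energyMap g‖) * ‖energyMap θ‖ := by
  refine (abs_real_inner_le_norm _ _).trans ?_
  have h1 : ‖mulL4 Ω (J f) (J g)‖ ≤ (C * ‖energyMap f‖) * (C * ‖energyMap g‖) :=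
    (norm_mulL4_le _ _).trans
      (mul_le_mul (hJC f) (hJC g) (norm_nonneg _) (mul_nonneg hC (norm_nonneg _)))
  refine (mul_le_mul h1 (norm_sumGrad_le θ) (norm_nonneg _)
    ((norm_nonneg _).trans h1)).trans_eq ?_
  ring

theorem abs_inner_fn_sumGrad_le (f θ : H02 Ω) :
    |⟪Sobolev.fn (f : Sobolev Ω 2), sumGrad θ⟫| ≤ n * (‖energyMap f‖ * ‖energyMap θ‖) := by
  refine (abs_real_inner_le_norm _ _).trans ?_
  refine (mul_le_mul (norm_fn_le f) (norm_sumGrad_le θ) (norm_nonneg _)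
    (norm_nonneg _)).trans_eq ?_
  ring

theorem rosenauForm_sub_le {α : ℝ} (hα : 0 < α)
    {J : H02 Ω →L[ℝ] Lp ℝ 4 (volume.restrict (Ω : Set (EuclideanSpace ℝ (Fin n))))}
    (hJ : IsInclusion J) {C M : ℝ} (hC : 0 ≤ C) (hM : 0 ≤ M)
    (hJC : ∀ v, ‖J v‖ ≤ C * ‖energyMap v‖) (v ρ θ : H02 Ω) (hv : ‖energyMap v‖ ≤ M)
    (hρ : ‖energyMap ρ‖ ≤ M) :
    rosenauForm α J v θ - rosenauForm α J (v - ρ - θ) θ ≤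
      2 * (α * n + n + 2 * n * C ^ 2 * M) * (‖energyMap ρ‖ ^ 2 + ‖energyMap θ‖ ^ 2) := by
  rw [rosenauForm_sub_eq hJ]
  exact galerkin_bound hα (Nat.cast_nonneg n) hM (norm_nonneg _) (norm_nonneg _) hv hρ
    (abs_sum_inner_grad_le ρ θ) (abs_sum_inner_grad_le θ θ) (abs_inner_fn_sumGrad_le ρ θ)
    (abs_inner_fn_sumGrad_le θ θ) (abs_inner_mulL4_sumGrad_le hC hJC v ρ θ)
    (abs_inner_mulL4_sumGrad_le hC hJC v θ θ) (abs_inner_mulL4_sumGrad_le hC hJC ρ ρ θ)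
    (abs_inner_mulL4_sumGrad_le hC hJC ρ θ θ)

end Rosenau

end

noncomputable section

namespace Rosenau

open Filter Topology
open scoped RealInnerProductSpace

/-! ### Weak time derivatives -/

theorem integral_timeMeasure {E : Type*} [NormedAddCommGroup E] [NormedSpace ℝ E] {T : ℝ}
    (hT : 0 ≤ T) (f : ℝ → E) : ∫ t, f t ∂(timeMeasure T) = ∫ t in (0 : ℝ)..T, f t := by
  rw [intervalIntegral.integral_of_le hT, integral_Ioc_eq_integral_Ioo]
  rfl

theorem intervalIntegrable_of_timeMeasure {E : Type*} [NormedAddCommGroup E] {T : ℝ}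
    (hT : 0 ≤ T) {f : ℝ → E} (hf : Integrable f (timeMeasure T)) :
    IntervalIntegrable f volume 0 T :=
  (intervalIntegrable_iff_integrableOn_Ioo_of_le hT).2 hf

theorem ContinuousOn.integrable_timeMeasure {E : Type*} [NormedAddCommGroup E] {T : ℝ}
    {f : ℝ → E} (hf : ContinuousOn f (Icc 0 T)) : Integrable f (timeMeasure T) :=
  (hf.integrableOn_Icc).mono_set Ioo_subset_Icc_self

theorem exists_test_integral_eq_one {T : ℝ} (hT : 0 < T) :
    ∃ η : 𝓓(timeInterval T, ℝ), ∫ t, η t = 1 := by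
  let f : ContDiffBump (T / 2) := ⟨T / 8, T / 4, by positivity, by linarith⟩
  refine ⟨⟨f.normed volume, f.contDiff_normed, f.hasCompactSupport_normed, ?_⟩, f.integral_normed⟩
  rw [f.tsupport_normed_eq, Real.closedBall_eq_Icc]
  have h4 : f.rOut = T / 4 := rfl
  rw [h4]
  exact Icc_subset_Ioo (by linarith) (by linarith)

/-- A test function with vanishing integral is the derivative of a test function. -/
theorem exists_test_deriv_eq {T : ℝ} (hT : 0 < T) (φ : 𝓓(timeInterval T, ℝ))
    (hφ : ∫ t, φ t = 0) : ∃ ψ : 𝓓(timeInterval T, ℝ), deriv ψ = φ := by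
  obtain ⟨a, b, ha, hb, hab⟩ : ∃ a b : ℝ, 0 < a ∧ b < T ∧ tsupport φ ⊆ Icc a b := by
    rcases (tsupport φ).eq_empty_or_nonempty with h | h
    -- For empty support the empty interval `Icc T 0` will do.
    · exact ⟨T, 0, hT, hT, by simp [h]⟩
    · obtain ⟨a, ha, ha'⟩ := φ.hasCompactSupport.isCompact.exists_isLeast h
      obtain ⟨b, hb, hb'⟩ := φ.hasCompactSupport.isCompact.exists_isGreatest h
      exact ⟨a, b, (φ.tsupport_subset ha).1, (φ.tsupport_subset hb).2,
        fun x hx => ⟨ha' hx, hb' hx⟩⟩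
  have h0 : ∀ x, x ∉ Icc a b → φ x = 0 := fun x hx =>
    image_eq_zero_of_notMem_tsupport fun h => hx (hab h)
  have hd : ∀ x, HasDerivAt (fun x => ∫ t in (0 : ℝ)..x, φ t) (φ x) x := fun x =>
    φ.continuous.integral_hasStrictDerivAt 0 x |>.hasDerivAt
  have hd' : deriv (fun x => ∫ t in (0 : ℝ)..x, φ t) = φ := funext fun x => (hd x).deriv
  have hsupp : tsupport (fun x => ∫ t in (0 : ℝ)..x, φ t) ⊆ Icc a b := by
    refine closure_minimal (fun x hx => ?_) isClosed_Icc
    by_contra hxn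
    refine hx ?_
    rcases lt_or_ge x a with hxa | hxa
    · refine intervalIntegral.integral_zero_ae (Eventually.of_forall fun t ht => h0 t fun h => ?_)
      have : t ≤ max 0 x := (mem_uIoc.1 ht).elim (fun h => le_max_of_le_right h.2)
        (fun h => le_max_of_le_left h.2)
      exact absurd (h.1.trans this) (not_le.2 (max_lt ha hxa))
    · have hbx : b < x := by
        by_contra hbx
        exact hxn ⟨hxa, not_lt.1 hbx⟩
      change ∫ t in (0 : ℝ)..x, φ t = 0
      -- To the right of the support the primitive equals the total integral, which vanishes by
      -- hypothesis.
      rw [intervalIntegral.integral_eq_integral_of_support_subset, hφ]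
      intro t ht
      have := hab (subset_tsupport _ ht)
      exact ⟨ha.trans_le this.1, this.2.trans hbx.le⟩
  refine ⟨⟨fun x => ∫ t in (0 : ℝ)..x, φ t, ?_, ?_, ?_⟩, hd'⟩
  · refine contDiff_infty_iff_deriv.2 ⟨fun x => (hd x).differentiableAt, ?_⟩
    rw [hd']
    exact φ.contDiff
  · exact HasCompactSupport.of_support_subset_isCompact isCompact_Icc
      ((subset_tsupport _).trans hsupp)
  · exact hsupp.trans (Icc_subset_Ioo ha hb)

/-- Integration by parts for absolutely continuous functions; the boundary terms vanish with `ψ`. -/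
theorem integral_deriv_mul_primitive {T : ℝ} (hT : 0 ≤ T) {g : ℝ → ℝ}
    (hg : Integrable g (timeMeasure T)) (ψ : 𝓓(timeInterval T, ℝ)) :
    ∫ t, deriv ψ t * (∫ s in (0 : ℝ)..t, g s) ∂(timeMeasure T) =
      -∫ t, ψ t * g t ∂(timeMeasure T) := by
  have hgi := intervalIntegrable_of_timeMeasure hT hg
  have hG := hgi.absolutelyContinuousOnInterval_intervalIntegral (c := 0) (by simp)
  have hψ : AbsolutelyContinuousOnInterval ψ 0 T :=
    (ψ.contDiff.of_le (by exact_mod_cast le_top)).contDiffOn.absolutelyContinuousOnInterval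
  have h := hψ.integral_mul_deriv_eq_deriv_mul hG
  have h0 : ∀ x, x ∉ Ioo 0 T → ψ x = 0 := fun x hx =>
    image_eq_zero_of_notMem_tsupport fun h => hx (ψ.tsupport_subset h)
  rw [h0 0 (by simp), h0 T (by simp), zero_mul, zero_mul, sub_zero, zero_sub] at h
  have h1 : ∫ x in (0 : ℝ)..T, ψ x * deriv (fun t => ∫ s in (0 : ℝ)..t, g s) x =
      ∫ x in (0 : ℝ)..T, ψ x * g x := by
    apply intervalIntegral.integral_congr_ae
    filter_upwards [hgi.ae_hasDerivAt_integral] with x hx hx'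
    rw [(hx (uIoc_subset_uIcc hx') 0 (by simp)).deriv]
  rw [integral_timeMeasure hT, integral_timeMeasure hT, ← h1, h, neg_neg]

theorem continuousOn_primitive {E : Type*} [NormedAddCommGroup E] [NormedSpace ℝ E] {T : ℝ}
    (hT : 0 ≤ T) {g : ℝ → E} (hg : Integrable g (timeMeasure T)) :
    ContinuousOn (fun t => ∫ s in (0 : ℝ)..t, g s) (Icc 0 T) := by
  have h := intervalIntegral.continuousOn_primitive_interval
    ((intervalIntegrable_iff' (by simp)).1 (intervalIntegrable_of_timeMeasure hT hg))
  rwa [uIcc_of_le hT] at h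

theorem eqOn_Icc_of_ae_eq_timeMeasure {E : Type*} [TopologicalSpace E] [T2Space E] {T : ℝ}
    (hT : 0 < T) {f g : ℝ → E} (hfg : f =ᵐ[timeMeasure T] g) (hf : ContinuousOn f (Icc 0 T))
    (hg : ContinuousOn g (Icc 0 T)) : EqOn f g (Icc 0 T) := by
  refine Measure.eqOn_Icc_of_ae_eq (μ := volume) hT.ne ?_ hf hg
  rw [← restrict_Ioo_eq_restrict_Icc]
  exact hfg

/-- The lemma of du Bois-Reymond. -/
theorem eq_of_integral_deriv_mul_eq_zero {T : ℝ} (hT : 0 < T) {w : ℝ → ℝ}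
    (hw : ContinuousOn w (Icc 0 T))
    (h : ∀ ψ : 𝓓(timeInterval T, ℝ), ∫ t, deriv ψ t * w t ∂(timeMeasure T) = 0)
    {t : ℝ} (ht : t ∈ Icc 0 T) : w t = w 0 := by
  obtain ⟨η, hη⟩ := exists_test_integral_eq_one hT
  have hwi := ContinuousOn.integrable_timeMeasure hw
  have hmul : ∀ φ : 𝓓(timeInterval T, ℝ), Integrable (fun t => φ t * w t) (timeMeasure T) :=
    fun φ => ContinuousOn.integrable_timeMeasure (φ.continuous.continuousOn.mul hw)
  have hint : ∀ φ : 𝓓(timeInterval T, ℝ), Integrable φ volume := fun φ =>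
    φ.continuous.integrable_of_hasCompactSupport φ.hasCompactSupport
  set c := ∫ t, η t * w t ∂(timeMeasure T) with hc
  -- Subtracting a multiple of `η` gives `φ` mean zero, hence makes it the derivative of a test
  -- function, to which `h` applies.
  have key : ∀ φ : 𝓓(timeInterval T, ℝ), ∫ t, φ t * (w t - c) ∂(timeMeasure T) = 0 := by
    intro φ
    have hz : ∫ t, (φ - (∫ s, φ s) • η : 𝓓(timeInterval T, ℝ)) t = 0 := by
      have e : ∀ t, (φ - (∫ s, φ s) • η : 𝓓(timeInterval T, ℝ)) t =
        φ t - (∫ s, φ s) * η t := fun t => rfl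
      simp only [e]
      rw [integral_sub (hint φ) ((hint η).const_mul _), integral_const_mul, hη, mul_one, sub_self]
    obtain ⟨ψ, hψ⟩ := exists_test_deriv_eq hT _ hz
    have h1 := h ψ
    rw [hψ] at h1
    have e : ∀ t, (φ - (∫ s, φ s) • η : 𝓓(timeInterval T, ℝ)) t * w t =
        φ t * w t - (∫ s, φ s) * (η t * w t) := fun t => by
      rw [← mul_assoc, ← sub_mul]
      rfl
    simp only [e] at h1
    rw [integral_sub (hmul φ) ((hmul η).const_mul _), integral_const_mul, ← hc] at h1
    have h2 : ∫ s, φ s = ∫ s, φ s ∂(timeMeasure T) := by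
      symm
      apply setIntegral_eq_integral_of_forall_compl_eq_zero
      intro x hx
      exact image_eq_zero_of_notMem_tsupport fun h => hx (φ.tsupport_subset h)
    simp only [mul_sub]
    rw [integral_sub (hmul φ) ((hint φ).restrict.mul_const c), integral_mul_const, ← h2]
    exact h1
  have hloc : LocallyIntegrableOn (fun t => w t - c) (Ioo 0 T) volume :=
    ((hw.sub continuousOn_const).mono Ioo_subset_Icc_self).locallyIntegrableOn measurableSet_Ioo
  have hae := isOpen_Ioo.ae_eq_zero_of_integral_contDiff_smul_eq_zero hloc (fun g hg hgc hgs => by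
    rw [← key ⟨g, hg, hgc, hgs⟩]
    symm
    apply setIntegral_eq_integral_of_forall_compl_eq_zero
    intro x hx
    change g x * (w x - c) = 0
    rw [image_eq_zero_of_notMem_tsupport (fun h => hx (hgs h)), zero_mul])
  have hwc : w =ᵐ[timeMeasure T] fun _ => c := by
    rw [timeMeasure, EventuallyEq, ae_restrict_iff' measurableSet_Ioo]
    filter_upwards [hae] with x hx hx'
    exact sub_eq_zero.1 (hx hx')
  have heq := eqOn_Icc_of_ae_eq_timeMeasure hT hwc hw continuousOn_const
  rw [heq ht, heq (left_mem_Icc.2 hT.le)]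

/-- A continuous function with an integrable weak derivative is a primitive of it. -/
theorem eq_add_integral_of_weak_deriv {E : Type*} [NormedAddCommGroup E] [InnerProductSpace ℝ E]
    [CompleteSpace E] {T : ℝ} (hT : 0 < T) {v g : ℝ → E} (hv : ContinuousOn v (Icc 0 T))
    (hg : Integrable g (timeMeasure T))
    (h : ∀ ψ : 𝓓(timeInterval T, ℝ),
      ∫ t, deriv ψ t • v t ∂(timeMeasure T) = -∫ t, ψ t • g t ∂(timeMeasure T))
    {t : ℝ} (ht : t ∈ Icc 0 T) : v t = v 0 + ∫ s in (0 : ℝ)..t, g s := by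
  -- Pairing with a fixed vector reduces the claim to the scalar lemma of du Bois-Reymond.
  refine ext_inner_left ℝ fun z => ?_
  have hgz : Integrable (fun s => ⟪z, g s⟫) (timeMeasure T) := hg.const_inner z
  have hvz : ContinuousOn (fun s => ⟪z, v s⟫) (Icc 0 T) := continuousOn_const.inner hv
  have hGz := continuousOn_primitive hT.le hgz
  have hd : ∀ ψ : 𝓓(timeInterval T, ℝ), Continuous (deriv ψ) := fun ψ =>
    ψ.contDiff.continuous_deriv (by simp)
  have hψg : ∀ ψ : 𝓓(timeInterval T, ℝ), Integrable (fun t => ψ t • g t) (timeMeasure T) := by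
    intro ψ
    obtain ⟨C, hC⟩ := ψ.continuous.bounded_above_of_compact_support ψ.hasCompactSupport
    exact hg.bdd_smul C ψ.continuous.aestronglyMeasurable (Eventually.of_forall hC)
  have hw := eq_of_integral_deriv_mul_eq_zero hT (hvz.sub hGz) (fun ψ => by
    have h1 := congrArg (fun x => ⟪z, x⟫) (h ψ)
    simp only [inner_neg_right] at h1
    have hdv : Integrable (fun t => deriv ψ t • v t) (timeMeasure T) :=
      ContinuousOn.integrable_timeMeasure ((hd ψ).continuousOn.smul hv)
    rw [← integral_inner hdv,
      ← integral_inner (hψg ψ)] at h1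
    simp only [inner_smul_right] at h1
    simp only [Pi.sub_apply, mul_sub]
    have i1 : Integrable (fun t => deriv ψ t * ⟪z, v t⟫) (timeMeasure T) :=
      ContinuousOn.integrable_timeMeasure ((hd ψ).continuousOn.mul hvz)
    have i2 : Integrable (fun t => deriv ψ t * ∫ s in (0 : ℝ)..t, ⟪z, g s⟫) (timeMeasure T) :=
      ContinuousOn.integrable_timeMeasure ((hd ψ).continuousOn.mul hGz)
    rw [integral_sub i1 i2, h1,
      integral_deriv_mul_primitive hT.le hgz, sub_self]) ht
  simp only [Pi.sub_apply, intervalIntegral.integral_same, sub_zero] at hw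
  have hgt : IntervalIntegrable g volume 0 t :=
    (intervalIntegrable_of_timeMeasure hT.le hg).mono_set (by
      rw [uIcc_of_le ht.1, uIcc_of_le hT.le]
      exact Icc_subset_Icc_right ht.2)
  have hzg : ∫ s in (0 : ℝ)..t, ⟪z, g s⟫ = ⟪z, ∫ s in (0 : ℝ)..t, g s⟫ :=
    (innerSL ℝ z).intervalIntegral_comp_comm hgt
  rw [inner_add_right, ← hzg]
  linarith

end Rosenau

end

/-! ### Continuous representative of the weak solution and the evolution identities. -/

noncomputable section

namespace Rosenau

open Filter Topology
open scoped RealInnerProductSpace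

theorem timeMeasure_univ {T : ℝ} : timeMeasure T Set.univ = ENNReal.ofReal T := by
  rw [timeMeasure, Measure.restrict_apply_univ, Real.volume_Ioo, sub_zero]

instance (T : ℝ) : IsFiniteMeasure (timeMeasure T) :=
  ⟨by rw [timeMeasure_univ]; exact ENNReal.ofReal_lt_top⟩

theorem eLpNorm_top_sq_add_eLpNorm_two_sq_le {T b : ℝ} (hT : 0 ≤ T) {f g : ℝ → ℝ}
    (hf : ∀ᵐ t ∂(timeMeasure T), ‖f t‖ ≤ b) (hg : ∀ᵐ t ∂(timeMeasure T), ‖g t‖ ≤ b)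
    (hb : 0 ≤ b) :
    eLpNorm f ∞ (timeMeasure T) ^ 2 + eLpNorm g 2 (timeMeasure T) ^ 2 ≤
      ENNReal.ofReal ((1 + T) * b ^ 2) := by
  have h1 : eLpNorm f ∞ (timeMeasure T) ≤ ENNReal.ofReal b := by
    rw [eLpNorm_exponent_top]
    exact eLpNormEssSup_le_of_ae_bound hf
  have h2 : eLpNorm g 2 (timeMeasure T) ^ 2 ≤ ENNReal.ofReal T * ENNReal.ofReal b ^ 2 := by
    have h3 := eLpNorm_le_of_ae_bound (p := 2) hg
    rw [timeMeasure_univ] at h3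
    have h4 : (ENNReal.ofReal T ^ (2 : ℝ≥0∞).toReal⁻¹) ^ 2 = ENNReal.ofReal T := by
      rw [← ENNReal.rpow_natCast, ← ENNReal.rpow_mul]
      norm_num
    calc _ ≤ (ENNReal.ofReal T ^ (2 : ℝ≥0∞).toReal⁻¹ * ENNReal.ofReal b) ^ 2 := by gcongr
      _ = _ := by rw [mul_pow, h4]
  calc _ ≤ ENNReal.ofReal b ^ 2 + ENNReal.ofReal T * ENNReal.ofReal b ^ 2 := by gcongr
    _ = _ := by
      rw [ENNReal.ofReal_mul (by positivity), ENNReal.ofReal_add zero_le_one hT,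
        ENNReal.ofReal_pow hb, ENNReal.ofReal_one, add_mul, one_mul]

/-- The distance to `K` is continuous along `X` and vanishes almost everywhere. -/
theorem mem_of_ae_mem_of_isClosed {E : Type*} [NormedAddCommGroup E] {T : ℝ} (hT : 0 < T)
    {K : Set E} (hK : IsClosed K) (hne : K.Nonempty) {X : ℝ → E} (hX : ContinuousOn X (Icc 0 T))
    (h : ∀ᵐ t ∂(timeMeasure T), X t ∈ K) {t : ℝ} (ht : t ∈ Icc 0 T) : X t ∈ K := by
  rw [hK.mem_iff_infDist_zero hne]
  refine eqOn_Icc_of_ae_eq_timeMeasure hT (f := fun t => Metric.infDist (X t) K)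
    (g := fun _ => 0) ?_ ((Metric.continuous_infDist_pt K).comp_continuousOn hX)
    continuousOn_const ht
  filter_upwards [h] with t ht
  exact Metric.infDist_zero_of_mem ht

theorem map_add_integral {E F : Type*} [NormedAddCommGroup E] [NormedSpace ℝ E] [CompleteSpace E]
    [NormedAddCommGroup F] [NormedSpace ℝ F] [CompleteSpace F] {T : ℝ} (hT : 0 ≤ T) (L : E →L[ℝ] F)
    (x : E) {g : ℝ → E} (hg : Integrable g (timeMeasure T)) {t : ℝ} (ht : t ∈ Icc 0 T) :
    L (x + ∫ s in (0 : ℝ)..t, g s) = L x + ∫ s in (0 : ℝ)..t, L (g s) := by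
  have hgt : IntervalIntegrable g volume 0 t :=
    (intervalIntegrable_of_timeMeasure hT hg).mono_set (by
      rw [uIcc_of_le ht.1, uIcc_of_le hT]
      exact Icc_subset_Icc_right ht.2)
  rw [map_add, L.intervalIntegral_comp_comm hgt]

theorem intervalIntegral_congr_timeMeasure {E : Type*} [NormedAddCommGroup E] [NormedSpace ℝ E]
    {T : ℝ} {f g : ℝ → E} (h : f =ᵐ[timeMeasure T] g) {t : ℝ} (ht : t ∈ Icc 0 T) :
    ∫ s in (0 : ℝ)..t, f s = ∫ s in (0 : ℝ)..t, g s := by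
  rw [intervalIntegral.integral_of_le ht.1, intervalIntegral.integral_of_le ht.1,
    integral_Ioc_eq_integral_Ioo, integral_Ioc_eq_integral_Ioo]
  exact integral_congr_ae (ae_restrict_of_ae_restrict_of_subset (Ioo_subset_Ioo_right ht.2) h)

theorem hasDerivAt_of_eq_add_integral {T : ℝ} {y f : ℝ → ℝ} {c : ℝ}
    (hf : ContinuousOn f (Icc 0 T))
    (hy : ∀ t ∈ Icc 0 T, y t = c + ∫ s in (0 : ℝ)..t, f s) {t : ℝ} (ht : t ∈ Ioo 0 T) :
    HasDerivAt y (f t) t := by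
  have hft : IntervalIntegrable f volume 0 t := by
    refine (hf.mono ?_).intervalIntegrable
    rw [uIcc_of_le ht.1.le]
    exact Icc_subset_Icc_right ht.2.le
  have hfo : ContinuousOn f (Ioo 0 T) := hf.mono Ioo_subset_Icc_self
  have h1 : HasDerivAt (fun t => c + ∫ s in (0 : ℝ)..t, f s) (f t) t :=
    (intervalIntegral.integral_hasDerivAt_right hft
      (hfo.stronglyMeasurableAtFilter isOpen_Ioo t ht)
      (hfo.continuousAt (isOpen_Ioo.mem_nhds ht))).const_add c
  refine h1.congr_of_eventuallyEq ?_
  filter_upwards [isOpen_Ioo.mem_nhds ht] with s hs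
  exact hy s (Ioo_subset_Icc_self hs)

variable {n : ℕ} {Ω : Opens (EuclideanSpace ℝ (Fin n))}

theorem fn_add_integral {T : ℝ} (hT : 0 ≤ T) {m : ℕ} (x : Sobolev Ω m) {g : ℝ → Sobolev Ω m}
    (hg : Integrable g (timeMeasure T)) {t : ℝ} (ht : t ∈ Icc 0 T) :
    Sobolev.fn (x + ∫ s in (0 : ℝ)..t, g s) =
      Sobolev.fn x + ∫ s in (0 : ℝ)..t, Sobolev.fn (g s) :=
  map_add_integral hT fnL x hg ht

theorem continuousOn_add_integral {T : ℝ} (hT : 0 ≤ T) {m : ℕ} (x : Sobolev Ω m)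
    {g : ℝ → Sobolev Ω m} (hg : Integrable g (timeMeasure T)) :
    ContinuousOn (fun t => x + ∫ s in (0 : ℝ)..t, g s) (Icc 0 T) :=
  continuousOn_const.add (continuousOn_primitive hT hg)

/-- The functional `v ↦ (v, χ) + (Δv, Δχ)` on `H²(Ω)`. -/
def energyFunctional (χ : H02 Ω) : Sobolev Ω 2 →L[ℝ] ℝ :=
  (innerSL ℝ (Sobolev.fn (χ : Sobolev Ω 2))).comp fnL +
    (innerSL ℝ (Sobolev.lap (χ : Sobolev Ω 2))).comp lapL

theorem energyFunctional_apply (χ : H02 Ω) (v : Sobolev Ω 2) :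
    energyFunctional χ v = ⟪Sobolev.fn v, Sobolev.fn (χ : Sobolev Ω 2)⟫ +
      ⟪Sobolev.lap v, Sobolev.lap (χ : Sobolev Ω 2)⟫ := by
  rw [real_inner_comm, real_inner_comm (Sobolev.lap (χ : Sobolev Ω 2)), ← lapL_apply v]
  rfl

/-- The continuous representative of a weak solution. -/
theorem IsWeakSolution.exists_representative {α T : ℝ} (hT : 0 < T) {u₀ : H02 Ω}
    {u : ℝ → H02 Ω} {ut : ℝ → Sobolev Ω 2} (hu : IsWeakSolution α T u₀ u ut) :
    ∃ U : ℝ → H02 Ω, ContinuousOn U (Icc 0 T) ∧ u =ᵐ[timeMeasure T] U ∧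
      (∀ t ∈ Icc 0 T, (U t : Sobolev Ω 2) =
        (u₀ : Sobolev Ω 2) + ∫ s in (0 : ℝ)..t, ut s) ∧
      ∀ t ∈ Icc 0 T, Sobolev.fn (U t : Sobolev Ω 2) =
        Sobolev.fn (u₀ : Sobolev Ω 2) + ∫ s in (0 : ℝ)..t, Sobolev.fn (ut s) := by
  have huti : Integrable ut (timeMeasure T) := hu.memLp_ut.integrable (by norm_num)
  have hfi : Integrable (fun t => Sobolev.fn (ut t)) (timeMeasure T) :=
    (fnL (m := 2) (Ω := Ω)).integrable_comp huti
  obtain ⟨v, hvc, huv, hv0⟩ := hu.initial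
  have hv : ∀ t ∈ Icc 0 T, v t = v 0 + ∫ s in (0 : ℝ)..t, Sobolev.fn (ut s) := by
    intro t ht
    refine eq_add_integral_of_weak_deriv hT hvc hfi (fun ψ => ?_) ht
    rw [← hu.weakTimeDeriv ψ]
    apply integral_congr_ae
    filter_upwards [huv] with s hs
    rw [← hs]
  let X : ℝ → Sobolev Ω 2 := fun t => (u₀ : Sobolev Ω 2) + ∫ s in (0 : ℝ)..t, ut s
  have hXc : ContinuousOn X (Icc 0 T) := continuousOn_add_integral hT.le _ huti
  have hXfn : ∀ t ∈ Icc 0 T, Sobolev.fn (X t) =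
      Sobolev.fn (u₀ : Sobolev Ω 2) + ∫ s in (0 : ℝ)..t, Sobolev.fn (ut s) := fun t ht =>
    fn_add_integral hT.le _ huti ht
  have huX : ∀ᵐ t ∂(timeMeasure T), (u t : Sobolev Ω 2) = X t := by
    filter_upwards [huv, ae_restrict_mem measurableSet_Ioo] with t h1 h2
    have h2' := Ioo_subset_Icc_self h2
    refine fnL_injective ?_
    rw [fnL_apply, fnL_apply, hXfn t h2', ← hv0, ← hv t h2']
    exact h1
  -- `ut` takes values in `H²` only, so membership of its primitive in `H02` has to come from the
  -- values of `u`.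
  have hXmem : ∀ t ∈ Icc 0 T, X t ∈ H02 Ω := fun t ht =>
    mem_of_ae_mem_of_isClosed hT isClosed_H02 ⟨0, (H02 Ω).zero_mem⟩ hXc
      (huX.mono fun t ht => ht ▸ (u t).2) ht
  classical
  let U : ℝ → H02 Ω := fun t => if h : t ∈ Icc 0 T then ⟨X t, hXmem t h⟩ else 0
  have hUX : ∀ t ∈ Icc 0 T, (U t : Sobolev Ω 2) = X t := by
    intro t ht
    simp only [U]
    rw [dif_pos ht]
  refine ⟨U, ?_, ?_, hUX, fun t ht => ?_⟩
  · rw [Topology.IsInducing.subtypeVal.continuousOn_iff]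
    exact hXc.congr fun t ht => hUX t ht
  · filter_upwards [huX, ae_restrict_mem measurableSet_Ioo] with t h1 h2
    exact Subtype.ext (h1.trans (hUX t (Ioo_subset_Icc_self h2)).symm)
  · rw [hUX t ht]
    exact hXfn t ht

theorem IsWeakSolution.energyFunctional_eq {α T : ℝ} {u₀ : H02 Ω}
    {u : ℝ → H02 Ω} {ut : ℝ → Sobolev Ω 2} (hu : IsWeakSolution α T u₀ u ut)
    {J : H02 Ω →L[ℝ] Lp ℝ 4 (volume.restrict (Ω : Set (EuclideanSpace ℝ (Fin n))))}
    (hJ : IsInclusion J) (χ : H02 Ω) :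
    ∀ᵐ t ∂(timeMeasure T), energyFunctional χ (ut t) = rosenauForm α J (u t) χ := by
  filter_upwards [hu.equation] with t ht
  obtain ⟨d, hd, h⟩ := ht
  have h1 := h χ
  rw [inner_weakDiv_eq hJ (u t) χ hd] at h1
  rw [energyFunctional_apply, rosenauForm]
  linarith

/-- The equation holds almost everywhere, but its right side agrees almost everywhere with a
continuous function of time; the primitive is thus differentiable at every interior point. -/
theorem hasDerivAt_inner_energyMap {α T : ℝ} (hT : 0 < T) {u₀ : H02 Ω}
    {u : ℝ → H02 Ω} {ut : ℝ → Sobolev Ω 2} (hu : IsWeakSolution α T u₀ u ut)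
    {J : H02 Ω →L[ℝ] Lp ℝ 4 (volume.restrict (Ω : Set (EuclideanSpace ℝ (Fin n))))}
    (hJ : IsInclusion J) {U : ℝ → H02 Ω} (hUc : ContinuousOn U (Icc 0 T))
    (huU : u =ᵐ[timeMeasure T] U)
    (hU : ∀ t ∈ Icc 0 T, (U t : Sobolev Ω 2) = (u₀ : Sobolev Ω 2) + ∫ s in (0 : ℝ)..t, ut s)
    (χ : H02 Ω) {t : ℝ} (ht : t ∈ Ioo 0 T) :
    HasDerivAt (fun t => ⟪energyMap (U t), energyMap χ⟫) (rosenauForm α J (U t) χ) t := by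
  have huti : Integrable ut (timeMeasure T) := hu.memLp_ut.integrable (by norm_num)
  refine hasDerivAt_of_eq_add_integral (f := fun t => rosenauForm α J (U t) χ)
    (c := energyFunctional χ (u₀ : Sobolev Ω 2))
    ((continuous_rosenauForm α J χ).comp_continuousOn hUc) (fun t ht => ?_) ht
  rw [inner_energyMap, ← energyFunctional_apply, hU t ht,
    map_add_integral hT.le (energyFunctional χ) _ huti ht]
  refine congrArg _ (intervalIntegral_congr_timeMeasure ?_ ht)
  filter_upwards [hu.energyFunctional_eq hJ χ, huU] with s h1 h2
  rw [h1, h2]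

theorem hasDerivAt_coe_submodule {E : Type*} [NormedAddCommGroup E] [NormedSpace ℝ E]
    {S : Submodule ℝ E} {f : ℝ → S} {f' : S} {t : ℝ} (h : HasDerivAt f f' t) :
    HasDerivAt (fun t => (f t : E)) f' t :=
  S.subtypeL.hasFDerivAt.comp_hasDerivAt t h

theorem hasDerivAt_energyFunctional (χ : H02 Ω) {S : Submodule ℝ (H02 Ω)} {f : ℝ → S} {f' : S}
    {t : ℝ} (h : HasDerivAt f f' t) :
    HasDerivAt (fun t => energyFunctional χ ((f t : H02 Ω) : Sobolev Ω 2))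
      (energyFunctional χ ((f' : H02 Ω) : Sobolev Ω 2)) t := by
  have h1 : HasDerivAt (fun t => (f t : H02 Ω)) f' t :=
    hasDerivAt_coe_submodule (E := H02 Ω) h
  have h2 : HasDerivAt (fun t => ((f t : H02 Ω) : Sobolev Ω 2)) (f' : H02 Ω) t :=
    hasDerivAt_coe_submodule (E := Sobolev Ω 2) h1
  exact (energyFunctional χ).hasFDerivAt.comp_hasDerivAt t h2

theorem IsSemidiscreteSolution.hasDerivAt_inner_energyMap {α T : ℝ} {S : Submodule ℝ (H02 Ω)}
    {u0h : S} {uh : ℝ → S} (huh : IsSemidiscreteSolution α T S u0h uh)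
    {J : H02 Ω →L[ℝ] Lp ℝ 4 (volume.restrict (Ω : Set (EuclideanSpace ℝ (Fin n))))}
    (hJ : IsInclusion J) (χ : S) {t : ℝ} (ht : t ∈ Ioo 0 T) :
    HasDerivAt (fun t => ⟪energyMap (uh t : H02 Ω), energyMap (χ : H02 Ω)⟫)
      (rosenauForm α J (uh t) χ) t := by
  obtain ⟨uht, hd, h⟩ := huh.equation t ht
  have h1 := h χ
  rw [← inner_flux_eq hJ (uh t) χ] at h1
  have h2 := hasDerivAt_energyFunctional (χ : H02 Ω) hd
  simp only [energyFunctional_apply, ← inner_energyMap] at h2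
  refine h2.congr_deriv ?_
  rw [inner_energyMap, rosenauForm]
  linarith

theorem IsSemidiscreteSolution.continuousOn_inner_energyMap {α T : ℝ} {S : Submodule ℝ (H02 Ω)}
    {u0h : S} {uh : ℝ → S} (huh : IsSemidiscreteSolution α T S u0h uh) (χ : H02 Ω) :
    ContinuousOn (fun t => ⟪energyMap (uh t : H02 Ω), energyMap χ⟫) (Icc 0 T) := by
  have h : Continuous fun v : H02 Ω => ⟪energyMap v, energyMap χ⟫ := by fun_prop
  exact h.comp_continuousOn (continuous_subtype_val.comp_continuousOn huh.continuousOn)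

/-- Both `uh 0` and `u0h` lie in `S`, so their difference is orthogonal to itself. -/
theorem IsSemidiscreteSolution.apply_zero {α T : ℝ} {S : Submodule ℝ (H02 Ω)}
    {u0h : S} {uh : ℝ → S} (huh : IsSemidiscreteSolution α T S u0h uh) :
    (uh 0 : H02 Ω) = u0h := by
  refine H02.ext_fn ?_
  have h1 := huh.initial (uh 0)
  have h2 := huh.initial u0h
  rw [← sub_eq_zero, ← inner_self_eq_zero (𝕜 := ℝ), inner_sub_left, inner_sub_right,
    inner_sub_right, h1, h2, real_inner_comm]
  ring

theorem HasApproxOrder.le {S : Submodule ℝ (H02 Ω)} {r : ℕ} {K h : ℝ}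
    (hS : HasApproxOrder S r K h) (v : H02 Ω) (w : Sobolev Ω r)
    (hw : Sobolev.fn w = Sobolev.fn (v : Sobolev Ω 2)) {c : ℝ}
    (hc : ∀ φ ∈ S, c ≤ ‖energyMap (v - φ)‖) : c ≤ K * h ^ (r - 2) * ‖w‖ :=
  (le_ciInf fun φ : S => (hc φ φ.2).trans (norm_energyMap_le_norm2 _)).trans (hS v w hw)

theorem norm1_le_norm2 (v : Sobolev Ω 2) : Sobolev.norm1 v ≤ Sobolev.norm2 v :=
  Real.sqrt_le_sqrt (by linarith [sq_nonneg ‖Sobolev.lap v‖])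

end Rosenau

end

/-! ### The error estimate. -/

noncomputable section

namespace Rosenau

open Filter Topology
open scoped RealInnerProductSpace

variable {n : ℕ} {Ω : Opens (EuclideanSpace ℝ (Fin n))}

/-- The error estimate in the energy norm, for the continuous representative `U` of the weak
solution, whose values have `H^r` norm at most `R`. -/
theorem norm_energyMap_sub_sq_le {α T : ℝ} (hα : 0 < α) (hT : 0 < T) {r : ℕ} {K : ℝ} (hK : 0 < K)
    {u₀ : H02 Ω} {u : ℝ → H02 Ω} {ut : ℝ → Sobolev Ω 2} (hu : IsWeakSolution α T u₀ u ut)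
    {J : H02 Ω →L[ℝ] Lp ℝ 4 (volume.restrict (Ω : Set (EuclideanSpace ℝ (Fin n))))}
    (hJ : IsInclusion J) {C₄ : ℝ} (hC₄ : 0 ≤ C₄) (hJC : ∀ v, ‖J v‖ ≤ C₄ * ‖energyMap v‖)
    {U : ℝ → H02 Ω} (hUc : ContinuousOn U (Icc 0 T)) (huU : u =ᵐ[timeMeasure T] U)
    (hU : ∀ t ∈ Icc 0 T, (U t : Sobolev Ω 2) = (u₀ : Sobolev Ω 2) + ∫ s in (0 : ℝ)..t, ut s)
    {M R : ℝ} (hM : 0 ≤ M) (hUM : ∀ t ∈ Icc 0 T, ‖energyMap (U t)‖ ≤ M)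
    (hUR : ∀ t ∈ Icc 0 T, ∃ w : Sobolev Ω r, Sobolev.fn w = Sobolev.fn (U t : Sobolev Ω 2) ∧
      ‖w‖ ≤ R) {h : ℝ} (hh : 0 < h) {S : Submodule ℝ (H02 Ω)} (hSf : FiniteDimensional ℝ S)
    (hS : HasApproxOrder S r K h) {u0h : S} {uh : ℝ → S}
    (huh : IsSemidiscreteSolution α T S u0h uh) {t : ℝ} (ht : t ∈ Ioo 0 T) :
    ‖energyMap (U t - (uh t : H02 Ω))‖ ^ 2 ≤
      Real.exp (2 * (2 * (α * n + n + 2 * n * C₄ ^ 2 * M)) * T) *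
        (‖energyMap (u₀ - (u0h : H02 Ω))‖ ^ 2 + (K * h ^ (r - 2) * R) ^ 2) := by
  have hU0 : U 0 = u₀ := by
    refine Subtype.ext ?_
    rw [hU 0 (left_mem_Icc.2 hT.le), intervalIntegral.integral_same, add_zero]
  have hD : 0 ≤ 2 * (α * n + n + 2 * n * C₄ ^ 2 * M) := by positivity
  have hmain := norm_sq_sub_le_of_galerkin (Λ := (energyMap (Ω := Ω)).toLinearMap)
    (Φ := rosenauForm α J) (T := T) (M := M) (ε := K * h ^ (r - 2) * R) (S := S) (U := U)
    (uh := fun t => (uh t : H02 Ω)) hD (rosenauForm_sum_smul α J)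
    (fun v ρ θ hv hρ => rosenauForm_sub_le hα hJ hC₄ hM hJC v ρ θ hv hρ)
    (fun t ht => hUM t (Ioo_subset_Icc_self ht))
    (fun t ht c hc => by
      obtain ⟨w, hw, hwR⟩ := hUR t (Ioo_subset_Icc_self ht)
      refine (hS.le (U t) w hw hc).trans ?_
      gcongr)
    (fun t => (uh t).2)
    (fun χ _ => by
      have hc : Continuous fun v : H02 Ω => ⟪energyMap v, energyMap χ⟫ := by fun_prop
      exact hc.comp_continuousOn hUc)
    (fun χ _ => huh.continuousOn_inner_energyMap χ)
    (fun χ _ t ht => hasDerivAt_inner_energyMap hT hu hJ hUc huU hU χ ht)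
    (fun χ hχ t ht => huh.hasDerivAt_inner_energyMap hJ ⟨χ, hχ⟩ ht) ht
  simp only [huh.apply_zero, hU0] at hmain
  exact hmain

theorem exists_sobolev_bound {T : ℝ} (hT : 0 < T) {r : ℕ} {u₀ : H02 Ω}
    (hu₀ : ∃ w : Sobolev Ω r, Sobolev.fn w = Sobolev.fn (u₀ : Sobolev Ω 2))
    {ut : ℝ → Sobolev Ω 2} (hut : InL2Sobolev T r fun t => Sobolev.fn (ut t)) {U : ℝ → H02 Ω}
    (hU : ∀ t ∈ Icc 0 T, Sobolev.fn (U t : Sobolev Ω 2) =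
      Sobolev.fn (u₀ : Sobolev Ω 2) + ∫ s in (0 : ℝ)..t, Sobolev.fn (ut s)) :
    ∃ R : ℝ, ∀ t ∈ Icc 0 T, ∃ w : Sobolev Ω r,
      Sobolev.fn w = Sobolev.fn (U t : Sobolev Ω 2) ∧ ‖w‖ ≤ R := by
  obtain ⟨w₀, hw₀⟩ := hu₀
  obtain ⟨V, hV, hVut⟩ := hut
  have hVi : Integrable V (timeMeasure T) := hV.integrable (by norm_num)
  -- The primitive is continuous into `H^r` on a compact interval, which gives a bound at every time
  -- rather than in mean square.
  obtain ⟨R, hR⟩ := isCompact_Icc.exists_bound_of_continuousOn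
    (continuousOn_add_integral hT.le w₀ hVi)
  refine ⟨R, fun t ht => ⟨w₀ + ∫ s in (0 : ℝ)..t, V s, ?_, hR t ht⟩⟩
  rw [fn_add_integral hT.le w₀ hVi ht, hU t ht, hw₀,
    intervalIntegral_congr_timeMeasure hVut ht]

theorem sq_le_of_sq_le_two_mul {x y a b E K R h : ℝ} {m : ℕ} (hE : 0 ≤ E) (ha : 0 ≤ a)
    (hab : a ≤ b) (hh : 0 < h) (hx : x ^ 2 ≤ 2 * y)
    (hy : y ≤ E * (a ^ 2 + (K * h ^ m * R) ^ 2)) :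
    x ^ 2 ≤ 2 * E * (1 + (K * R) ^ 2) * (b ^ 2 + h ^ (2 * m)) := by
  have h1 : (K * h ^ m * R) ^ 2 = (K * R) ^ 2 * h ^ (2 * m) := by
    rw [mul_comm 2 m, pow_mul]
    ring
  have h2 : 0 ≤ h ^ (2 * m) := by positivity
  have h3 : a ^ 2 ≤ b ^ 2 := by gcongr
  have h4 : a ^ 2 + (K * h ^ m * R) ^ 2 ≤ (1 + (K * R) ^ 2) * (b ^ 2 + h ^ (2 * m)) := by
    rw [h1]
    nlinarith [mul_nonneg (sq_nonneg (K * R)) (sq_nonneg b)]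
  calc x ^ 2 ≤ 2 * (E * ((1 + (K * R) ^ 2) * (b ^ 2 + h ^ (2 * m)))) := by
        refine hx.trans (mul_le_mul_of_nonneg_left (hy.trans ?_) zero_le_two)
        exact mul_le_mul_of_nonneg_left h4 hE
    _ = _ := by ring

theorem eLpNorm_add_le_of_sq_le {T B : ℝ} (hT : 0 ≤ T) (hB : 0 ≤ B) {f g : ℝ → ℝ}
    (hg : ∀ t, 0 ≤ g t) (hgf : ∀ t, g t ≤ f t) (hf : ∀ᵐ t ∂(timeMeasure T), f t ^ 2 ≤ B) :
    eLpNorm f ∞ (timeMeasure T) ^ 2 + eLpNorm g 2 (timeMeasure T) ^ 2 ≤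
      ENNReal.ofReal ((1 + T) * B) := by
  refine (eLpNorm_top_sq_add_eLpNorm_two_sq_le hT (b := √B) ?_ ?_
    (Real.sqrt_nonneg _)).trans_eq (by rw [Real.sq_sqrt hB])
  · filter_upwards [hf] with t ht
    rw [Real.norm_of_nonneg ((hg t).trans (hgf t))]
    exact Real.le_sqrt_of_sq_le ht
  · filter_upwards [hf] with t ht
    rw [Real.norm_of_nonneg (hg t)]
    exact (hgf t).trans (Real.le_sqrt_of_sq_le ht)

/-- The constant of the error estimate depends on the weak solution, but not on `h`, on the
trial space or on the semidiscrete solution. -/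
theorem IsWeakSolution.exists_error_bound (hn : 1 ≤ n) (hn2 : n ≤ 2)
    (hΩ : Bornology.IsBounded (Ω : Set (EuclideanSpace ℝ (Fin n)))) {α T : ℝ} (hα : 0 < α)
    (hT : 0 < T) {r : ℕ} {K : ℝ} (hK : 0 < K) {u₀ : H02 Ω}
    (hu₀ : ∃ w : Sobolev Ω r, Sobolev.fn w = Sobolev.fn (u₀ : Sobolev Ω 2))
    {u : ℝ → H02 Ω} {ut : ℝ → Sobolev Ω 2} (hu : IsWeakSolution α T u₀ u ut)
    (hut : InL2Sobolev T r fun t => Sobolev.fn (ut t)) :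
    ∃ C : ℝ, 0 < C ∧ ∀ h : ℝ, 0 < h →
      ∀ S : Submodule ℝ (H02 Ω), FiniteDimensional ℝ S → HasApproxOrder S r K h →
      ∀ (u0h : S) (uh : ℝ → S), IsSemidiscreteSolution α T S u0h uh →
        ∀ᵐ t ∂(timeMeasure T),
          Sobolev.norm2 ((u t - (uh t : H02 Ω) : H02 Ω) : Sobolev Ω 2) ^ 2 ≤
            C * (Sobolev.norm2 ((u₀ - (u0h : H02 Ω) : H02 Ω) : Sobolev Ω 2) ^ 2 +
              h ^ (2 * (r - 2))) := by
  obtain ⟨J, hJ, C₄, hC₄, hJC⟩ := exists_L4_embedding hn hn2 hΩ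
  obtain ⟨U, hUc, huU, hU, hUfn⟩ := hu.exists_representative hT
  obtain ⟨M, hM⟩ := isCompact_Icc.exists_bound_of_continuousOn
    ((energyMap (Ω := Ω)).continuous.comp_continuousOn hUc)
  have hM0 : 0 ≤ M := (norm_nonneg _).trans (hM 0 (left_mem_Icc.2 hT.le))
  obtain ⟨R, hR⟩ := exists_sobolev_bound hT hu₀ hut hUfn
  have hE := Real.exp_pos (2 * (2 * (α * n + n + 2 * n * C₄ ^ 2 * M)) * T)
  refine ⟨2 * Real.exp (2 * (2 * (α * n + n + 2 * n * C₄ ^ 2 * M)) * T) * (1 + (K * R) ^ 2),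
    mul_pos (mul_pos two_pos hE) (by positivity), ?_⟩
  intro h hh S hSf hS u0h uh huh
  filter_upwards [huU, ae_restrict_mem measurableSet_Ioo] with t ht1 ht2
  rw [ht1]
  exact sq_le_of_sq_le_two_mul hE.le (norm_nonneg _) (norm_energyMap_le_norm2 _) hh
    (norm2_sq_le _)
    (norm_energyMap_sub_sq_le hα hT hK hu hJ hC₄ hJC hUc huU hU hM0 hM hR hh hSf hS huh ht2)

end Rosenau

end


open Rosenau Rosenau.Sobolev in
theorem mainTheorem3 {n : ℕ} (hn : 1 ≤ n) (hn2 : n ≤ 2)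
    (Ω : Opens (EuclideanSpace ℝ (Fin n)))
    (hΩ : Bornology.IsBounded (Ω : Set (EuclideanSpace ℝ (Fin n))))
    (α T : ℝ) (hα : 0 < α) (hT : 0 < T) (r : ℕ) (hr : 3 < r) (K : ℝ) (hK : 0 < K)
    (u₀ : H02 Ω) (hu₀ : ∃ w : Sobolev Ω r, fn w = fn (u₀ : Sobolev Ω 2))
    (u : ℝ → H02 Ω) (ut : ℝ → Sobolev Ω 2) (hu : IsWeakSolution α T u₀ u ut)
    (hu_reg : InL2Sobolev T r (fun t => fn (u t : Sobolev Ω 2)))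
    (hut_reg : InL2Sobolev T r (fun t => fn (ut t))) :
    ∃ C : ℝ, 0 < C ∧
      ∀ (h : ℝ), 0 < h → h < 1 →
      ∀ (S : Submodule ℝ (H02 Ω)), FiniteDimensional ℝ S → HasApproxOrder S r K h →
      ∀ (u0h : S) (uh : ℝ → S), IsSemidiscreteSolution α T S u0h uh →
        eLpNorm (fun t => norm2 ((u t - (uh t : H02 Ω) : H02 Ω) : Sobolev Ω 2)) ∞
            (timeMeasure T) ^ 2 +
          eLpNorm (fun t => norm1 ((u t - (uh t : H02 Ω) : H02 Ω) : Sobolev Ω 2)) 2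
            (timeMeasure T) ^ 2 ≤
        ENNReal.ofReal
          (C * (norm2 ((u₀ - (u0h : H02 Ω) : H02 Ω) : Sobolev Ω 2) ^ 2 + h ^ (2 * (r - 2)))) := by
  obtain ⟨C, hC, hbound⟩ := hu.exists_error_bound hn hn2 hΩ hα hT hK hu₀ hut_reg
  -- The essential supremum contributes `C`, and integration over the time interval contributes `T *
  -- C`.
  refine ⟨(1 + T) * C, mul_pos (add_pos one_pos hT) hC, ?_⟩
  intro h hh _ S hSf hS u0h uh huh
  rw [mul_assoc]
  exact eLpNorm_add_le_of_sq_le hT.le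
    (mul_nonneg hC.le (add_nonneg (sq_nonneg _) (pow_nonneg hh.le _)))
    (fun _ => Real.sqrt_nonneg _) (fun _ => norm1_le_norm2 _) (hbound h hh S hSf hS u0h uh huh)
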